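/- **Setting.** Let $m\ge n$, and give $\mathbb{R}^{m\times n}$ the Frobenius inner product and norm $\|\cdot\|_F$. Let $\mathcal D$ be a probability distribution and let $f(X;\xi)$ be real-valued losses, differentiable in $X\in\mathbb{R}^{m\times n}$, measurable and $\mathcal D$-integrable in $\xi$. Put $f(X)=\mathbb{E}_{\xi\sim\mathcal D}[f(X;\xi)]$. Let $L,\sigma,\mu>0$ and $f^*\in\mathbb{R}$, and assume: 1. (lower bound) $f(X)\ge f^*$ for all $X$; 2. ($L$-smoothness) $f$ is differentiable and $\|\nabla f(Y)-\nabla f(X)\|_F\le L\|Y-X\|_F$ for all $X,Y$; 3. (unbiasedness, bounded variance) $\mathbb{E}_\xi[\nabla f(X;\xi)]=\nabla f(X)$ and $\mathbb{E}_\xi\|\nabla f(X;\xi)-\nabla f(X)\|_F^2\le\sigma^2$ for all $X$. **Algorithm (Muon-MVR1).** Start from a deterministic $X_1\in\mathbb{R}^{m\times n}$ with $M_0=0$. Let $\xi_1,\xi_2,\dots$ be i.i.d. samples from $\mathcal D$, each $\xi_{t+1}$ being independent of everything that happened up to time $t$. Write $g_0=0$ and $g_t=\nabla f(X_t;\xi_t)$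 for $t\ge1$. For $t=1,2,\dots$ set $$M_t=\beta_tM_{t-1}+(1-\beta_t)g_t+\gamma_t\beta_t\,(g_t-g_{t-1}),\qquad X_{t+1}=X_t-\eta_tO_t .$$ Here $O_t$ is a measurable choice, using only information available at time $t$, of either $O_t=U_rV_r^\top$, where $M_t=U_r\Sigma_rV_r^\top$ is a compact singular value decomposition, or a minimizer of $\|O-M_t\|_F$ subject to $O^\top O=I_n$. (The two coincide when $M_t$ has rank $n$.) **Theorem.** Let the iterates be generated with $\eta_t=t^{-3/4}$ and with one of the options * $\gamma_t=0$ and $\beta_t=1-t^{-1/2}$ for all $t\ge1$; * $\gamma_t=t^{-1/2}$ and $\beta_t=1-(t+1)^{-1/2}$ for all $t\ge1$. Assume also that $f$ satisfies the $\mu$-PL inequality along the iterates: for every $t\ge1$, almost surely, $\|\nabla f(X_t)\|_F^2\ge2\mu\,(f(X_t)-f^*)$ (this holds in particular if the inequality holds at every $X\in\mathbb{R}^{m\times n}$). Then $$\mathbb{E}[f(X_{T+1})]-f^*=\mathcal{O}\!\left(\frac{(\ln T)^2}{T^{1/2}}\right).$$ More precisely, there is a constant $C>0$ depending only on $n,L,\sigma,\mu$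 such that for every such run there is a threshold $T_0$ with the following property: for all $T\ge T_0$, $f(X_{T+1})$ is integrable and $\mathbb{E}[f(X_{T+1})]-f^*\le C\,(\ln T)^2/T^{1/2}$. -/

import Mathlib

open MeasureTheory ProbabilityTheory
open scoped Gradient

noncomputable section

/-- Real `m × n` matrices with the Frobenius inner product `⟪A, B⟫ = tr (Aᵀ B)`, realized as the
Euclidean space of their entries. The norm `‖A‖` is the Frobenius norm
(see `MatSpace.inner_eq_trace` and `MatSpace.norm_sq_eq_trace`). -/
abbrev MatSpace (m n : ℕ) : Type := EuclideanSpace ℝ (Fin m × Fin n)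

/-- The matrix with the given entries. -/
def MatSpace.toMatrix {m n : ℕ} (A : MatSpace m n) : Matrix (Fin m) (Fin n) ℝ :=
  Matrix.of fun i j => A (i, j)

theorem MatSpace.inner_eq_trace {m n : ℕ} (A B : MatSpace m n) :
    inner ℝ A B = (A.toMatrix.transpose * B.toMatrix).trace := by
  simp only [PiLp.inner_apply, Matrix.trace, Matrix.diag, Matrix.mul_apply,
    Matrix.transpose_apply, MatSpace.toMatrix, Matrix.of_apply, Fintype.sum_prod_type]
  rw [Finset.sum_comm]
  simp [mul_comm]

theorem MatSpace.norm_sq_eq_trace {m n : ℕ} (A : MatSpace m n) :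
    ‖A‖ ^ 2 = (A.toMatrix.transpose * A.toMatrix).trace := by
  rw [← MatSpace.inner_eq_trace, real_inner_self_eq_norm_sq]

/-- `O = U Vᵀ` for a compact singular value decomposition `M = U diag(s) Vᵀ`, where `s` lists the
(strictly positive) singular values of `M` and `U`, `V` have orthonormal columns. -/
def IsPolarFactor {m n : ℕ} (M O : MatSpace m n) : Prop :=
  ∃ (r : ℕ) (U : Matrix (Fin m) (Fin r) ℝ) (V : Matrix (Fin n) (Fin r) ℝ) (s : Fin r → ℝ),
    U.transpose * U = 1 ∧ V.transpose * V = 1 ∧ (∀ i, 0 < s i) ∧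
    M.toMatrix = U * Matrix.diagonal s * V.transpose ∧
    O.toMatrix = U * V.transpose

/-- `O` minimizes `‖Q - M‖_F` over all `Q` with `Qᵀ Q = I_n`. -/
def IsProcrustesSolution {m n : ℕ} (M O : MatSpace m n) : Prop :=
  O.toMatrix.transpose * O.toMatrix = 1 ∧
  ∀ Q : MatSpace m n, Q.toMatrix.transpose * Q.toMatrix = 1 → ‖O - M‖ ≤ ‖Q - M‖

/-- The orthogonalized momentum. The two descriptions agree when `M` has full column rank; when
`M` is rank deficient, either one is allowed. -/
def IsMuonDirection {m n : ℕ} (M O : MatSpace m n) : Prop :=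
  IsPolarFactor M O ∨ IsProcrustesSolution M O

/-- The objective `f(X) = E_{z ∼ D} [ℓ(X; z)]`. -/
def objective {m n : ℕ} {Ξ : Type*} [MeasurableSpace Ξ] (D : Measure Ξ)
    (ℓ : MatSpace m n → Ξ → ℝ) (X : MatSpace m n) : ℝ :=
  ∫ z, ℓ X z ∂D

/-- The stochastic gradient `∇f(X; z)`: the gradient in `X` of the sample loss. -/
def stochGrad {m n : ℕ} {Ξ : Type*} (ℓ : MatSpace m n → Ξ → ℝ) (X : MatSpace m n) (z : Ξ) :
    MatSpace m n :=
  ∇ (fun Y => ℓ Y z) X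

/-- The sample losses are differentiable in the parameter and have an expectation. -/
structure IsSampleLoss {m n : ℕ} {Ξ : Type*} [MeasurableSpace Ξ] (D : Measure Ξ)
    (ℓ : MatSpace m n → Ξ → ℝ) : Prop where
  measurable : ∀ X, Measurable (ℓ X)
  integrable : ∀ X, Integrable (ℓ X) D
  differentiable : ∀ z, Differentiable ℝ fun X => ℓ X z

/-- `f` is differentiable with `L`-Lipschitz gradient in the Frobenius norm. -/
def IsLSmooth {m n : ℕ} (f : MatSpace m n → ℝ) (L : ℝ) : Prop :=
  Differentiable ℝ f ∧ ∀ X Y, ‖∇ f Y - ∇ f X‖ ≤ L * ‖Y - X‖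

/-- Unbiased stochastic gradients with variance at most `σ²`. -/
structure HasBoundedVariance {m n : ℕ} {Ξ : Type*} [MeasurableSpace Ξ] (D : Measure Ξ)
    (ℓ : MatSpace m n → Ξ → ℝ) (σ : ℝ) : Prop where
  integrable : ∀ X, Integrable (stochGrad ℓ X) D
  unbiased : ∀ X, ∫ z, stochGrad ℓ X z ∂D = ∇ (objective D ℓ) X
  integrable_sq : ∀ X, Integrable (fun z => ‖stochGrad ℓ X z - ∇ (objective D ℓ) X‖ ^ 2) D
  variance_le : ∀ X, ∫ z, ‖stochGrad ℓ X z - ∇ (objective D ℓ) X‖ ^ 2 ∂D ≤ σ ^ 2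

/-- The `μ`-PL inequality for `f` at the point `X`, relative to the value `fstar`. -/
def PLAt {m n : ℕ} (f : MatSpace m n → ℝ) (fstar μ : ℝ) (X : MatSpace m n) : Prop :=
  2 * μ * (f X - fstar) ≤ ‖∇ f X‖ ^ 2

/-- The samples `ξ 1, ξ 2, …` are drawn from `D`, each one known at its own time and independent
of the past. (So they are i.i.d. with law `D`; the filtration may carry extra randomness.) -/
structure IsSampling {Ω Ξ : Type*} [MeasurableSpace Ω] [MeasurableSpace Ξ] (P : Measure Ω)
    (D : Measure Ξ) (ℱ : Filtration ℕ ‹MeasurableSpace Ω›) (ξ : ℕ → Ω → Ξ) : Prop where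
  adapted : ∀ t, 1 ≤ t → Measurable[ℱ t] (ξ t)
  law : ∀ t, 1 ≤ t → P.map (ξ t) = D
  indep : ∀ t, Indep (MeasurableSpace.comap (ξ (t + 1)) inferInstance) (ℱ t) P

/-- The stochastic gradient used at step `t ≥ 1`, with the convention that it is `0` at step `0`. -/
def gradAt {m n : ℕ} {Ω Ξ : Type*} (ℓ : MatSpace m n → Ξ → ℝ) (ξ : ℕ → Ω → Ξ)
    (X : ℕ → Ω → MatSpace m n) (t : ℕ) (ω : Ω) : MatSpace m n :=
  if t = 0 then 0 else stochGrad ℓ (X t ω) (ξ t ω)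

/-- `(X, M, O)` is a run of Muon with one-batch momentum variance reduction (Muon-MVR1), started
at `X 1 = x₁` with `M 0 = 0`, with step sizes `η t`, momentum parameters `β t` and
variance-reduction parameters `γ t`. The direction `O t` may use no information beyond time `t`. -/
structure IsMuonMVR1Run {m n : ℕ} {Ω Ξ : Type*} [MeasurableSpace Ω]
    (ℓ : MatSpace m n → Ξ → ℝ) (ℱ : Filtration ℕ ‹MeasurableSpace Ω›) (ξ : ℕ → Ω → Ξ)
    (η β γ : ℕ → ℝ) (x₁ : MatSpace m n) (X M O : ℕ → Ω → MatSpace m n) : Prop where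
  init_param : ∀ ω, X 1 ω = x₁
  init_momentum : ∀ ω, M 0 ω = 0
  momentum : ∀ t ω, M (t + 1) ω =
    β (t + 1) • M t ω + (1 - β (t + 1)) • gradAt ℓ ξ X (t + 1) ω
      + (γ (t + 1) * β (t + 1)) • (gradAt ℓ ξ X (t + 1) ω - gradAt ℓ ξ X t ω)
  direction : ∀ t, 1 ≤ t → ∀ ω, IsMuonDirection (M t ω) (O t ω)
  direction_adapted : ∀ t, 1 ≤ t → Measurable[ℱ t] (O t)
  step : ∀ t, 1 ≤ t → ∀ ω, X (t + 1) ω = X t ω - η t • O t ω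

end

/-!
Write `A_t = √(f(X_t) - f*)`, `d = n + 1`, and let `S_t = M_t - ∇f(X_t)` be the momentum error. The
orthogonalized direction satisfies `‖O_t‖ ≤ d` and `‖M_t‖ ≤ d ⟪M_t, O_t⟫`
(`IsMuonDirection.norm_le`, `IsMuonDirection.norm_le_inner`). Smoothness and the lower bound make
`A_t` Lipschitz along the steps (`IsLSmooth.sqrt_gap_le`), and the PL inequality makes it decrease
by a fixed multiple of `η_t` as long as `‖S_t‖` is small compared with `A_t`
(`IsLSmooth.sqrt_gap_le_sub`).

The PL inequality bounds the gradient norm below by a multiple of `A_t`, and Jensen's inequality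
points the wrong way for turning `E A_t` into `E A_t ^ 2`. A drift argument for `A_t` replaces it.
For a final time `T = q ^ 4` and times `t` in a window `δ ^ 4 T ≤ t ≤ T`, the quantities `q A_t` and
`q ^ 2 ‖S_t‖ ^ 2` evolve on the same time scale, with unit of time `q ^ 2` steps: the first one grows
by at most a bounded amount per unit of time and decreases while it dominates the second one, and the second
one is contracted in conditional expectation up to a bounded term. So
`exp (ℓ q A_t) (1 + (second quantity) / r)` has an expectation that contracts geometrically towards
a level independent of `T` (`exp_mul_one_add_drift`, `IsMuonPLRun.lintegral_lyapunov_succ_le`).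

Two points make this work. First, with variance reduction the previous noise enters the update of
`M_t` and is not centred given the past. Subtracting `γ_{t+1} N_t` from `S_t`, where `N_t` is the
gradient noise, removes it, and the remaining error is driven by fresh noise only
(`IsMuonPLRun.shiftedError_succ`). Expectations are computed as lower Lebesgue integrals, where a
fresh sample can be integrated out by Tonelli's theorem without integrability conditions
(`IsSampling.lintegral_eq`). Second, at the start of the window `q A_t` is only known to be at most
of order `δ q ^ 2`, so that the Lyapunov function may have order `exp (O(ℓ δ q ^ 2))`, while the
window contracts it by `exp (-ρ q ^ 2 / 2)`, with `ρ` proportional to `ℓ`. A small `δ`, chosen before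
`ℓ`, lets the contraction win (`nonempty_driftConstants`,
`IsMuonPLRun.exists_lintegral_lyapunov_le`). The resulting bound is
`E A_T ^ 2 = O(T ^ (-1 / 2))`, which is stronger than the claim by the logarithmic factor.
-/

/-! ### The orthogonalized direction -/

theorem IsPolarFactor.norm_le {m n : ℕ} {M O : MatSpace m n} (h : IsPolarFactor M O) :
    ‖O‖ ≤ (n : ℝ) + 1 := by
  obtain ⟨r, U, V, s, hU, hV, -, -, hO⟩ := h
  have hrn : r ≤ n := by
    have h1 : (V.transpose * V).rank = r := by rw [hV, Matrix.rank_one, Fintype.card_fin]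
    have h2 := Matrix.rank_mul_le_right V.transpose V
    have h3 := Matrix.rank_le_card_height V
    rw [Fintype.card_fin] at h3
    omega
  have hsq : ‖O‖ ^ 2 = r := by
    rw [MatSpace.norm_sq_eq_trace, hO, Matrix.transpose_mul, Matrix.transpose_transpose,
      Matrix.mul_assoc, ← Matrix.mul_assoc U.transpose, hU, Matrix.one_mul, Matrix.trace_mul_comm,
      hV, Matrix.trace_one, Fintype.card_fin]
  have : (r : ℝ) ≤ n := by exact_mod_cast hrn
  nlinarith [norm_nonneg O]

theorem IsPolarFactor.norm_le_inner {m n : ℕ} {M O : MatSpace m n} (h : IsPolarFactor M O) :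
    ‖M‖ ≤ inner ℝ M O := by
  obtain ⟨r, U, V, s, hU, hV, hs, hM, hO⟩ := h
  have h1 : inner ℝ M O = ∑ i, s i := by
    rw [MatSpace.inner_eq_trace, hM, hO, Matrix.transpose_mul, Matrix.transpose_mul,
      Matrix.transpose_transpose, Matrix.diagonal_transpose, Matrix.mul_assoc, Matrix.mul_assoc,
      ← Matrix.mul_assoc U.transpose, hU, Matrix.one_mul, Matrix.trace_mul_comm,
      Matrix.mul_assoc, hV, Matrix.mul_one, Matrix.trace_diagonal]
  have h2 : ‖M‖ ^ 2 = ∑ i, s i ^ 2 := by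
    rw [MatSpace.norm_sq_eq_trace, hM, Matrix.transpose_mul, Matrix.transpose_mul,
      Matrix.transpose_transpose, Matrix.diagonal_transpose, Matrix.mul_assoc, Matrix.mul_assoc,
      Matrix.mul_assoc, ← Matrix.mul_assoc U.transpose, hU, Matrix.one_mul, Matrix.trace_mul_comm,
      Matrix.mul_assoc, Matrix.mul_assoc, hV, Matrix.mul_one, Matrix.diagonal_mul_diagonal,
      Matrix.trace_diagonal]
    simp only [sq]
  have h3 : 0 ≤ ∑ i, s i := Finset.sum_nonneg fun i _ => (hs i).le
  have h4 : ∑ i, s i ^ 2 ≤ (∑ i, s i) ^ 2 :=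
    Finset.sum_sq_le_sq_sum_of_nonneg fun i _ => (hs i).le
  rw [h1]
  exact abs_le_of_sq_le_sq' (by rw [h2]; exact h4) h3 |>.2

theorem norm_sq_of_transpose_mul_self {m n : ℕ} {Q : MatSpace m n}
    (hQ : Q.toMatrix.transpose * Q.toMatrix = 1) : ‖Q‖ ^ 2 = n := by
  rw [MatSpace.norm_sq_eq_trace, hQ, Matrix.trace_one, Fintype.card_fin]

/-- Some matrix with orthonormal columns is well correlated with `M`: one of its columns is the
normalized longest column of `M`, and the other columns complete it to an orthonormal family, with
signs that make their contributions to the inner product nonnegative. -/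
theorem exists_orthonormal_norm_le_inner {m n : ℕ} (hmn : n ≤ m) (M : MatSpace m n) (hM : M ≠ 0) :
    ∃ Q : MatSpace m n, Q.toMatrix.transpose * Q.toMatrix = 1 ∧
      ‖M‖ ≤ ((n : ℝ) + 1) * inner ℝ Q M := by
  classical
  let col : Fin n → EuclideanSpace ℝ (Fin m) := fun j => WithLp.toLp 2 fun i => M (i, j)
  have hMsq : ‖M‖ ^ 2 = ∑ j, ‖col j‖ ^ 2 := by
    simp only [EuclideanSpace.norm_sq_eq, Fintype.sum_prod_type, col]
    rw [Finset.sum_comm]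
  have hne : Nonempty (Fin n) := by
    by_contra hcon
    rw [not_nonempty_iff] at hcon
    apply hM
    rw [← norm_eq_zero, ← sq_eq_zero_iff, hMsq]
    simp
  obtain ⟨j₀, hj₀⟩ := Finite.exists_max fun j => ‖col j‖
  have hbound : ‖M‖ ≤ ((n : ℝ) + 1) * ‖col j₀‖ := by
    have h1 : ‖M‖ ^ 2 ≤ n * ‖col j₀‖ ^ 2 := by
      rw [hMsq]
      calc ∑ j, ‖col j‖ ^ 2 ≤ ∑ _j : Fin n, ‖col j₀‖ ^ 2 :=
            Finset.sum_le_sum fun j _ => pow_le_pow_left₀ (norm_nonneg _) (hj₀ j) 2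
        _ = n * ‖col j₀‖ ^ 2 := by simp
    refine abs_le_of_sq_le_sq' (h1.trans ?_) (by positivity) |>.2
    have h2 : (0 : ℝ) ≤ n := Nat.cast_nonneg n
    nlinarith [sq_nonneg ‖col j₀‖, mul_nonneg h2 (sq_nonneg ‖col j₀‖),
      mul_nonneg (mul_nonneg h2 h2) (sq_nonneg ‖col j₀‖)]
  have hcol : ‖col j₀‖ ≠ 0 := by
    intro h0
    rw [h0, mul_zero] at hbound
    exact hM (norm_le_zero_iff.1 hbound)
  let e : Fin n → Fin m := Fin.castLE hmn
  have he : Function.Injective e := Fin.castLE_injective hmn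
  have hcard : Module.finrank ℝ (EuclideanSpace ℝ (Fin m)) = Fintype.card (Fin m) := by simp
  have hon : Orthonormal ℝ (({e j₀} : Set (Fin m)).domRestrict
      fun _ : Fin m => (‖col j₀‖⁻¹ • col j₀)) := by
    refine ⟨fun i => ?_, fun i k hik => ?_⟩
    · simp only [Set.domRestrict_apply, norm_smul, norm_inv, norm_norm]
      exact inv_mul_cancel₀ hcol
    · exact absurd (Subsingleton.elim i k) hik
  obtain ⟨b, hb⟩ := hon.exists_orthonormalBasis_extension_of_card_eq hcard
  have hb0 : b (e j₀) = ‖col j₀‖⁻¹ • col j₀ := hb _ rfl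
  let sg : Fin n → ℝ := fun j => if 0 ≤ inner ℝ (b (e j)) (col j) then 1 else -1
  have hsg : ∀ j, sg j * sg j = 1 := by
    intro j; simp only [sg]; split_ifs <;> norm_num
  let Q : MatSpace m n := WithLp.toLp 2 fun p => sg p.2 * b (e p.2) p.1
  refine ⟨Q, ?_, ?_⟩
  · ext j k
    have h1 : (Q.toMatrix.transpose * Q.toMatrix) j k
        = sg j * sg k * inner ℝ (b (e j)) (b (e k)) := by
      simp only [Matrix.mul_apply, Matrix.transpose_apply, MatSpace.toMatrix, Matrix.of_apply, Q,
        PiLp.inner_apply, Finset.mul_sum]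
      refine Finset.sum_congr rfl fun i _ => ?_
      simp only [RCLike.inner_apply, conj_trivial]
      ring
    rw [h1, orthonormal_iff_ite.1 b.orthonormal]
    by_cases hjk : j = k
    · subst hjk; simp [hsg]
    · rw [if_neg (fun h => hjk (he h)), Matrix.one_apply_ne hjk, mul_zero]
  · have h1 : inner ℝ Q M = ∑ j, sg j * inner ℝ (b (e j)) (col j) := by
      simp only [PiLp.inner_apply, Fintype.sum_prod_type, Q, Finset.mul_sum, col]
      rw [Finset.sum_comm]
      refine Finset.sum_congr rfl fun j _ => Finset.sum_congr rfl fun i _ => ?_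
      simp only [RCLike.inner_apply, conj_trivial]
      ring
    have h2 : ∀ j, 0 ≤ sg j * inner ℝ (b (e j)) (col j) := by
      intro j; simp only [sg]; split_ifs with h
      · simpa using h
      · push Not at h; linarith
    have h3 : sg j₀ * inner ℝ (b (e j₀)) (col j₀) = ‖col j₀‖ := by
      have : inner ℝ (b (e j₀)) (col j₀) = ‖col j₀‖ := by
        rw [hb0, real_inner_smul_left, real_inner_self_eq_norm_sq]
        field_simp
      simp only [sg, this, if_pos (norm_nonneg _), one_mul]
    refine hbound.trans (mul_le_mul_of_nonneg_left ?_ (by positivity))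
    rw [h1, ← h3]
    exact Finset.single_le_sum (f := fun j => sg j * inner ℝ (b (e j)) (col j))
      (fun j _ => h2 j) (Finset.mem_univ j₀)

theorem IsProcrustesSolution.norm_le_inner {m n : ℕ} (hmn : n ≤ m) {M O : MatSpace m n}
    (h : IsProcrustesSolution M O) : ‖M‖ ≤ ((n : ℝ) + 1) * inner ℝ M O := by
  rcases eq_or_ne M 0 with rfl | hM
  · simp
  obtain ⟨Q, hQ, hQM⟩ := exists_orthonormal_norm_le_inner hmn M hM
  have h1 := pow_le_pow_left₀ (norm_nonneg _) (h.2 Q hQ) 2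
  rw [norm_sub_sq_real, norm_sub_sq_real, norm_sq_of_transpose_mul_self h.1,
    norm_sq_of_transpose_mul_self hQ] at h1
  refine hQM.trans (mul_le_mul_of_nonneg_left ?_ (by positivity))
  rw [real_inner_comm O M]
  linarith

theorem IsMuonDirection.norm_le {m n : ℕ} {M O : MatSpace m n} (h : IsMuonDirection M O) :
    ‖O‖ ≤ (n : ℝ) + 1 := by
  rcases h with h | h
  · exact h.norm_le
  · have := norm_sq_of_transpose_mul_self h.1
    have h2 : (0 : ℝ) ≤ n := Nat.cast_nonneg n
    nlinarith [norm_nonneg O]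

theorem IsMuonDirection.norm_le_inner {m n : ℕ} (hmn : n ≤ m) {M O : MatSpace m n}
    (h : IsMuonDirection M O) : ‖M‖ ≤ ((n : ℝ) + 1) * inner ℝ M O := by
  rcases h with h | h
  · have h1 := h.norm_le_inner
    have h2 : (0 : ℝ) ≤ n := Nat.cast_nonneg n
    nlinarith [norm_nonneg M]
  · exact h.norm_le_inner hmn

/-! ### Smooth objectives -/

/-- The descent lemma. -/
theorem IsLSmooth.le_quadratic {m n : ℕ} {f : MatSpace m n → ℝ} {L : ℝ} (hf : IsLSmooth f L)
    (X V : MatSpace m n) : f (X + V) ≤ f X + inner ℝ (∇ f X) V + L / 2 * ‖V‖ ^ 2 := by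
  have hγ : ∀ s : ℝ, HasDerivAt (fun s : ℝ => X + s • V) V s := fun s => by
    simpa using ((hasDerivAt_id s).smul_const V).const_add X
  have hd : ∀ s : ℝ, HasDerivAt (fun s : ℝ => f (X + s • V)) (inner ℝ (∇ f (X + s • V)) V) s := by
    intro s
    rw [inner_gradient_left]
    exact (hf.1 (X + s • V)).hasFDerivAt.comp_hasDerivAt s (hγ s)
  have hB : ∀ s : ℝ, HasDerivAt (fun s : ℝ => f X + s * inner ℝ (∇ f X) V + L / 2 * ‖V‖ ^ 2 * s ^ 2)
      (inner ℝ (∇ f X) V + L * ‖V‖ ^ 2 * s) s := by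
    intro s
    have h1 := (((hasDerivAt_id s).mul_const (inner ℝ (∇ f X) V)).const_add (f X)).add
      ((hasDerivAt_pow 2 s).const_mul (L / 2 * ‖V‖ ^ 2))
    refine h1.congr_deriv ?_
    norm_num
    ring
  have key := image_le_of_deriv_right_le_deriv_boundary (a := (0 : ℝ)) (b := 1)
    (f := fun s : ℝ => f (X + s • V)) (f' := fun s : ℝ => inner ℝ (∇ f (X + s • V)) V)
    (B := fun s : ℝ => f X + s * inner ℝ (∇ f X) V + L / 2 * ‖V‖ ^ 2 * s ^ 2)
    (B' := fun s : ℝ => inner ℝ (∇ f X) V + L * ‖V‖ ^ 2 * s)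
    (fun s _ => (hd s).continuousAt.continuousWithinAt) (fun s _ => (hd s).hasDerivWithinAt)
    (by simp) (fun s _ => (hB s).continuousAt.continuousWithinAt)
    (fun s _ => (hB s).hasDerivWithinAt) ?_ (x := 1) (by simp)
  · simpa using key
  · intro s hs
    have h1 : inner ℝ (∇ f (X + s • V) - ∇ f X) V ≤ L * ‖V‖ ^ 2 * s := by
      calc inner ℝ (∇ f (X + s • V) - ∇ f X) V ≤ ‖∇ f (X + s • V) - ∇ f X‖ * ‖V‖ :=
            real_inner_le_norm _ _
        _ ≤ (L * ‖X + s • V - X‖) * ‖V‖ :=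
            mul_le_mul_of_nonneg_right (hf.2 _ _) (norm_nonneg _)
        _ = L * ‖V‖ ^ 2 * s := by
            rw [add_sub_cancel_left, norm_smul, Real.norm_of_nonneg hs.1]; ring
    rw [inner_sub_left] at h1
    have h2 : inner ℝ (∇ f (X + s • V)) V ≤ inner ℝ (∇ f X) V + L * ‖V‖ ^ 2 * s := by linarith
    exact h2

/-- For a smooth function bounded below, the squared gradient norm is controlled by the gap: a
gradient step of length `1 / L` cannot go below the lower bound. -/
theorem IsLSmooth.norm_gradient_sq_le {m n : ℕ} {f : MatSpace m n → ℝ} {L fstar : ℝ} (hL : 0 < L)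
    (hf : IsLSmooth f L) (hlow : ∀ X, fstar ≤ f X) (X : MatSpace m n) :
    ‖∇ f X‖ ^ 2 ≤ 2 * L * (f X - fstar) := by
  have h1 := hf.le_quadratic X (-(1 / L) • ∇ f X)
  have h2 := hlow (X + -(1 / L) • ∇ f X)
  rw [real_inner_smul_right, real_inner_self_eq_norm_sq, norm_smul, mul_pow, Real.norm_eq_abs,
    sq_abs] at h1
  have h3 : L / 2 * ((-(1 / L)) ^ 2 * ‖∇ f X‖ ^ 2) = 1 / (2 * L) * ‖∇ f X‖ ^ 2 := by
    field_simp
  have h4 : -(1 / L) * ‖∇ f X‖ ^ 2 = -(2 * (1 / (2 * L) * ‖∇ f X‖ ^ 2)) := by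
    field_simp
  rw [h3, h4] at h1
  have h5 : 1 / (2 * L) * ‖∇ f X‖ ^ 2 ≤ f X - fstar := by linarith
  have h6 : ‖∇ f X‖ ^ 2 = 2 * L * (1 / (2 * L) * ‖∇ f X‖ ^ 2) := by field_simp
  rw [h6]
  exact mul_le_mul_of_nonneg_left h5 (by positivity)

/-- The square root of the gap is Lipschitz along steps of length `η * d`. -/
theorem IsLSmooth.sqrt_gap_le {m n : ℕ} {f : MatSpace m n → ℝ} {L fstar d η : ℝ} (hL : 0 < L)
    (hf : IsLSmooth f L) (hlow : ∀ X, fstar ≤ f X) (hη : 0 ≤ η) {X O : MatSpace m n}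
    (hO : ‖O‖ ≤ d) :
    √(f (X - η • O) - fstar) ≤ √(f X - fstar) + η * (d * √(L / 2)) := by
  have hd : 0 ≤ d := (norm_nonneg O).trans hO
  set A := √(f X - fstar) with hA
  set l := √(L / 2) with hl
  have hA2 : A ^ 2 = f X - fstar := Real.sq_sqrt (sub_nonneg.2 (hlow X))
  have hl2 : l ^ 2 = L / 2 := Real.sq_sqrt (by positivity)
  have hA0 : 0 ≤ A := Real.sqrt_nonneg _
  have hl0 : 0 ≤ l := Real.sqrt_nonneg _
  have hg : ‖∇ f X‖ ≤ 2 * l * A := by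
    refine abs_le_of_sq_le_sq' ?_ (by positivity) |>.2
    calc ‖∇ f X‖ ^ 2 ≤ 2 * L * (f X - fstar) := hf.norm_gradient_sq_le hL hlow X
      _ = (2 * l * A) ^ 2 := by rw [mul_pow, mul_pow, hA2, hl2]; ring
  have h1 := hf.le_quadratic X (-(η • O))
  rw [← sub_eq_add_neg, norm_neg, norm_smul, Real.norm_of_nonneg hη] at h1
  have h2 : inner ℝ (∇ f X) (-(η • O)) ≤ 2 * l * A * (η * d) := by
    calc inner ℝ (∇ f X) (-(η • O)) ≤ ‖∇ f X‖ * ‖-(η • O)‖ := real_inner_le_norm _ _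
      _ = ‖∇ f X‖ * (η * ‖O‖) := by rw [norm_neg, norm_smul, Real.norm_of_nonneg hη]
      _ ≤ 2 * l * A * (η * d) := by gcongr
  have h3 : L / 2 * (η * ‖O‖) ^ 2 ≤ l ^ 2 * (η * d) ^ 2 := by
    rw [hl2]; gcongr
  apply Real.sqrt_le_iff.2
  refine ⟨by positivity, ?_⟩
  nlinarith

/-- If the momentum error is small compared with the square root of the gap, and that square root
is not small compared with the step, then it decreases by a definite multiple of the step. -/
theorem IsLSmooth.sqrt_gap_le_sub {m n : ℕ} {f : MatSpace m n → ℝ} {L fstar d η μ θ : ℝ}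
    (hL : 0 < L) (hμ : 0 < μ) (hf : IsLSmooth f L) (hlow : ∀ X, fstar ≤ f X) (hη : 0 ≤ η)
    (hd : 1 ≤ d) (hθ : θ = √(2 * μ) / (2 * d)) {X M O : MatSpace m n} (hO : ‖O‖ ≤ d)
    (hMO : ‖M‖ ≤ d * inner ℝ M O) (hPL : PLAt f fstar μ X)
    (hS : ‖M - ∇ f X‖ ≤ θ / (2 * d) * √(f X - fstar))
    (hA : (L * d ^ 2 / θ + θ) * η ≤ √(f X - fstar)) :
    √(f (X - η • O) - fstar) ≤ √(f X - fstar) - η * (θ / 4) := by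
  set A := √(f X - fstar) with hAdef
  have hA2 : A ^ 2 = f X - fstar := Real.sq_sqrt (sub_nonneg.2 (hlow X))
  have hA0 : 0 ≤ A := Real.sqrt_nonneg _
  have hd0 : 0 < d := by linarith
  have hμ0 : 0 < √(2 * μ) := Real.sqrt_pos.2 (by positivity)
  have hθ0 : 0 < θ := by rw [hθ]; positivity
  have hμθ : √(2 * μ) = 2 * d * θ := by rw [hθ]; field_simp
  set S := ‖M - ∇ f X‖ with hSdef
  have hS0 : 0 ≤ S := norm_nonneg _
  have hg : 2 * d * θ * A ≤ ‖∇ f X‖ := by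
    refine abs_le_of_sq_le_sq' ?_ (norm_nonneg _) |>.2
    have h2 := Real.sq_sqrt (show (0 : ℝ) ≤ 2 * μ by positivity)
    rw [hμθ] at h2
    rw [mul_pow, h2, hA2]
    exact hPL
  have hM : ‖∇ f X‖ - S ≤ ‖M‖ := by
    have : ‖∇ f X‖ ≤ ‖M‖ + ‖M - ∇ f X‖ := by
      have h := norm_sub_norm_le (∇ f X) M
      rw [norm_sub_rev] at h
      linarith
    linarith
  have hin : inner ℝ M O - S * d ≤ inner ℝ (∇ f X) O := by
    have h1 : inner ℝ (M - ∇ f X) O ≤ S * d :=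
      (real_inner_le_norm _ _).trans (mul_le_mul_of_nonneg_left hO hS0)
    rw [inner_sub_left] at h1
    linarith
  have hθA : θ * A ≤ inner ℝ (∇ f X) O := by
    have h2 : (2 * d * θ * A - S) / d ≤ inner ℝ M O := by
      rw [div_le_iff₀ hd0]
      linarith
    have h3 : S * (2 * d) ≤ θ * A := by
      calc S * (2 * d) ≤ θ / (2 * d) * A * (2 * d) := by gcongr
        _ = θ * A := by field_simp
    have h4 : (2 * d * θ * A - S) / d = 2 * θ * A - S / d := by field_simp
    have h5 : S / d ≤ S * d := by
      rw [div_le_iff₀ hd0]; nlinarith [mul_nonneg hS0 (by nlinarith : (0 : ℝ) ≤ d * d - 1)]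
    nlinarith
  have h1 := hf.le_quadratic X (-(η • O))
  rw [← sub_eq_add_neg, norm_neg, norm_smul, Real.norm_of_nonneg hη, inner_neg_right,
    real_inner_smul_right] at h1
  have h3 : L / 2 * (η * ‖O‖) ^ 2 ≤ L / 2 * (η * d) ^ 2 := by gcongr
  have h4 : L * d ^ 2 * η ≤ θ * A := by
    have h5 : L * d ^ 2 / θ * η ≤ A := by nlinarith
    calc L * d ^ 2 * η = θ * (L * d ^ 2 / θ * η) := by field_simp
      _ ≤ θ * A := by gcongr
  have h6 : θ * η ≤ A := by
    have : 0 ≤ L * d ^ 2 / θ * η := by positivity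
    nlinarith
  apply Real.sqrt_le_iff.2
  constructor
  · nlinarith
  · have h7 : η * (θ * A) ≤ η * inner ℝ (∇ f X) O := by gcongr
    have h8 : η * (L * d ^ 2 * η) ≤ η * (θ * A) := by gcongr
    nlinarith [sq_nonneg (η * θ)]

/-! ### The exponential Lyapunov function -/

/-- One step of the exponential Lyapunov function `exp (ℓ a) (1 + w)`. Here `w` contracts up to a
small additive term, `a` grows by at most `C₁ h`, and it decreases by `c h` as soon as it is at
least `a₀` and `w` is not too large compared with `a ^ 2`. -/
theorem exp_mul_one_add_drift {ℓ c C₁ ρ a₀ k h a a' w : ℝ} (hh : 0 < h) (hh1 : h ≤ 1) (hℓ : 0 < ℓ)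
    (hc : ℓ * c = 2 * ρ) (hρ : 0 < ρ) (hρ1 : ρ ≤ 1 / 32) (hC : ℓ * C₁ ≤ 1 / 16) (hk0 : 0 ≤ k)
    (ha₀ : 0 ≤ a₀) (hk : 1 ≤ k * a₀ ^ 2) (hw : 0 ≤ w) (hup : a' ≤ a + C₁ * h)
    (hdown : a₀ ≤ a → w ≤ k * a ^ 2 → a' ≤ a - c * h) :
    Real.exp (ℓ * a') * (1 + ((1 - h / 2) * w + ρ * h))
      ≤ Real.exp (-(ρ * h)) * (Real.exp (ℓ * a) * (1 + w))
        + Real.exp (ℓ * a₀) * (1 + k * a₀ ^ 2) * h := by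
  have hρh : 0 < ρ * h := mul_pos hρ hh
  have hnn : 0 ≤ Real.exp (ℓ * a₀) * (1 + k * a₀ ^ 2) * h := by positivity
  have hfac : 0 ≤ 1 + ((1 - h / 2) * w + ρ * h) := by
    have : 0 ≤ (1 - h / 2) * w := mul_nonneg (by linarith) hw
    linarith
  have hfac1 : 1 + ((1 - h / 2) * w + ρ * h) ≤ (1 + w) * Real.exp (ρ * h) := by
    have h1 := Real.add_one_le_exp (ρ * h)
    have h2 : (1 + w) * (ρ * h + 1) ≤ (1 + w) * Real.exp (ρ * h) := by gcongr
    nlinarith [mul_nonneg hw hh.le, mul_nonneg hw hρh.le]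
  have hgrow : Real.exp (ℓ * a') ≤ Real.exp (ℓ * a + h / 16) := by
    apply Real.exp_le_exp.2
    have h1 : ℓ * a' ≤ ℓ * (a + C₁ * h) := by gcongr
    have h2 : ℓ * C₁ * h ≤ 1 / 16 * h := by gcongr
    nlinarith
  have hlarge : 1 ≤ w → Real.exp (ℓ * a') * (1 + ((1 - h / 2) * w + ρ * h))
      ≤ Real.exp (-(ρ * h)) * (Real.exp (ℓ * a) * (1 + w)) := by
    intro hw1
    have h1 : 1 + ((1 - h / 2) * w + ρ * h) ≤ (1 + w) * Real.exp (-(h / 8)) := by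
      have h2 := Real.add_one_le_exp (-(h / 8))
      have h3 : (1 + w) * (-(h / 8) + 1) ≤ (1 + w) * Real.exp (-(h / 8)) := by gcongr
      have h4 : ρ * h ≤ 1 / 32 * h := by gcongr
      nlinarith [mul_le_mul_of_nonneg_right hw1 hh.le]
    calc Real.exp (ℓ * a') * (1 + ((1 - h / 2) * w + ρ * h))
        ≤ Real.exp (ℓ * a + h / 16) * ((1 + w) * Real.exp (-(h / 8))) := by gcongr
      _ = Real.exp (-(h / 16)) * (Real.exp (ℓ * a) * (1 + w)) := by
          rw [Real.exp_add, show -(h / 16) = h / 16 + -(h / 8) by ring, Real.exp_add]; ring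
      _ ≤ Real.exp (-(ρ * h)) * (Real.exp (ℓ * a) * (1 + w)) := by
          gcongr
          nlinarith
  -- Either `a` decreases, or `w` is at least `1` and its contraction outweighs the growth of `a`
  -- (`hlarge`), or `a` and `w` are both bounded and so is the increment per unit of `h`.
  by_cases hcase : a₀ ≤ a
  · by_cases hwa : w ≤ k * a ^ 2
    · have h1 : Real.exp (ℓ * a') ≤ Real.exp (ℓ * a - 2 * (ρ * h)) := by
        apply Real.exp_le_exp.2
        have h1 : ℓ * a' ≤ ℓ * (a - c * h) := by
          have := hdown hcase hwa
          gcongr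
        nlinarith
      calc Real.exp (ℓ * a') * (1 + ((1 - h / 2) * w + ρ * h))
          ≤ Real.exp (ℓ * a - 2 * (ρ * h)) * ((1 + w) * Real.exp (ρ * h)) := by gcongr
        _ = Real.exp (-(ρ * h)) * (Real.exp (ℓ * a) * (1 + w)) := by
            rw [show ℓ * a - 2 * (ρ * h) = -(ρ * h) + ℓ * a + -(ρ * h) by ring, Real.exp_add,
              Real.exp_add, Real.exp_neg (ρ * h)]
            field_simp
        _ ≤ _ := le_add_of_nonneg_right hnn
    · push Not at hwa
      refine (hlarge ?_).trans (le_add_of_nonneg_right hnn)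
      have : k * a₀ ^ 2 ≤ k * a ^ 2 := by gcongr
      linarith
  · push Not at hcase
    by_cases hw1 : 1 ≤ w
    · exact (hlarge hw1).trans (le_add_of_nonneg_right hnn)
    · push Not at hw1
      have h1 : Real.exp (h / 16) * Real.exp (ρ * h) ≤ Real.exp (-(ρ * h)) + h := by
        have h2 : Real.exp (h / 16) * Real.exp (ρ * h) ≤ Real.exp (h * (3 / 32)) := by
          rw [← Real.exp_add]
          apply Real.exp_le_exp.2
          nlinarith
        have h3 := Real.add_one_le_exp (-(ρ * h))
        have h4 : Real.exp (h * (3 / 32)) ≤ 1 + h / 2 := by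
          have h5 := Real.add_one_le_exp (-(h * (3 / 32)))
          rw [Real.exp_neg] at h5
          have h6 : 0 < Real.exp (h * (3 / 32)) := Real.exp_pos _
          have h7 : (-(h * (3 / 32)) + 1) * Real.exp (h * (3 / 32)) ≤ 1 := by
            calc _ ≤ (Real.exp (h * (3 / 32)))⁻¹ * Real.exp (h * (3 / 32)) := by gcongr
              _ = 1 := inv_mul_cancel₀ h6.ne'
          nlinarith
        nlinarith
      calc Real.exp (ℓ * a') * (1 + ((1 - h / 2) * w + ρ * h))
          ≤ Real.exp (ℓ * a + h / 16) * ((1 + w) * Real.exp (ρ * h)) := by gcongr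
        _ = (Real.exp (h / 16) * Real.exp (ρ * h)) * (Real.exp (ℓ * a) * (1 + w)) := by
            rw [Real.exp_add]; ring
        _ ≤ (Real.exp (-(ρ * h)) + h) * (Real.exp (ℓ * a) * (1 + w)) := by gcongr
        _ = Real.exp (-(ρ * h)) * (Real.exp (ℓ * a) * (1 + w))
            + Real.exp (ℓ * a) * (1 + w) * h := by ring
        _ ≤ _ := by gcongr; linarith

/-- Iterating `u (t + 1) ≤ exp (-(ρ h)) u t + B h`: a geometric decay of the initial value towards
a level that does not depend on the step `h`. -/
theorem le_exp_mul_add_of_recursion {u : ℕ → ENNReal} {ρ h B : ℝ} {t₀ T : ℕ} (hh : 0 < h)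
    (hρ : 0 < ρ) (hρh : ρ * h ≤ 1) (hB : 0 ≤ B) (ht₀ : t₀ ≤ T)
    (hu : ∀ t, t₀ ≤ t → t < T →
      u (t + 1) ≤ ENNReal.ofReal (Real.exp (-(ρ * h))) * u t + ENNReal.ofReal (B * h)) :
    u T ≤ ENNReal.ofReal (Real.exp (-(ρ * h * (T - t₀ : ℝ)))) * u t₀
      + ENNReal.ofReal (2 * B / ρ) := by
  induction T, ht₀ using Nat.le_induction with
  | base => simp
  | succ T hT ih =>
    have ih' := ih fun t h1 h2 => hu t h1 (h2.trans (Nat.lt_succ_self T))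
    have hq : Real.exp (-(ρ * h)) * (2 * B / ρ) + B * h ≤ 2 * B / ρ := by
      have h1 : Real.exp (-(ρ * h)) ≤ 1 - ρ * h / 2 := by
        have hx : 0 < ρ * h := mul_pos hρ hh
        have h2 := Real.add_one_le_exp (ρ * h)
        rw [Real.exp_neg, inv_le_comm₀ (Real.exp_pos _) (by linarith)]
        refine le_trans ?_ h2
        rw [inv_le_iff_one_le_mul₀ (by linarith)]
        nlinarith
      calc Real.exp (-(ρ * h)) * (2 * B / ρ) + B * h
          ≤ (1 - ρ * h / 2) * (2 * B / ρ) + B * h := by gcongr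
        _ = 2 * B / ρ := by field_simp; ring
    calc u (T + 1) ≤ ENNReal.ofReal (Real.exp (-(ρ * h))) * u T + ENNReal.ofReal (B * h) :=
          hu T hT (Nat.lt_succ_self T)
      _ ≤ ENNReal.ofReal (Real.exp (-(ρ * h))) *
            (ENNReal.ofReal (Real.exp (-(ρ * h * (T - t₀ : ℝ)))) * u t₀
              + ENNReal.ofReal (2 * B / ρ)) + ENNReal.ofReal (B * h) := by gcongr
      _ = ENNReal.ofReal (Real.exp (-(ρ * h * ((T + 1 : ℕ) - t₀ : ℝ)))) * u t₀
            + ENNReal.ofReal (Real.exp (-(ρ * h)) * (2 * B / ρ) + B * h) := by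
          rw [mul_add, ← mul_assoc, ← ENNReal.ofReal_mul (Real.exp_pos _).le, ← Real.exp_add,
            ← ENNReal.ofReal_mul (Real.exp_pos _).le, add_assoc,
            ← ENNReal.ofReal_add (by positivity) (by positivity)]
          congr 4
          push_cast; ring
      _ ≤ _ := by gcongr

/-! ### Stochastic gradients and fresh samples -/

/-- The stochastic gradient is jointly measurable: the loss is, being continuous in the parameter,
and the partial derivatives are limits of difference quotients. -/
theorem IsSampleLoss.measurable_stochGrad {m n : ℕ} {Ξ : Type*} [MeasurableSpace Ξ] {D : Measure Ξ}
    {ℓ : MatSpace m n → Ξ → ℝ} (hℓ : IsSampleLoss D ℓ) :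
    Measurable fun p : MatSpace m n × Ξ => stochGrad ℓ p.1 p.2 := by
  have hjoint : Measurable fun p : MatSpace m n × Ξ => ℓ p.1 p.2 :=
    measurable_uncurry_of_continuous_of_measurable
      (fun z => (hℓ.differentiable z).continuous) hℓ.measurable
  suffices hcoord : ∀ q, Measurable fun p : MatSpace m n × Ξ => stochGrad ℓ p.1 p.2 q by
    exact (WithLp.measurable_toLp 2 _).comp (measurable_pi_iff.2 hcoord)
  intro q
  refine measurable_of_tendsto_metrizable (f := fun (k : ℕ) (p : MatSpace m n × Ξ) =>
    (k : ℝ) • (ℓ (p.1 + (k : ℝ)⁻¹ • EuclideanSpace.single q 1) p.2 - ℓ p.1 p.2)) (fun k => ?_) ?_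
  · refine Measurable.const_smul (Measurable.sub ?_ hjoint) (k : ℝ)
    exact hjoint.comp ((measurable_fst.add_const _).prodMk measurable_snd)
  · rw [tendsto_pi_nhds]
    intro p
    have h1 : stochGrad ℓ p.1 p.2 q
        = fderiv ℝ (fun Y => ℓ Y p.2) p.1 (EuclideanSpace.single q 1) := by
      rw [← inner_gradient_left, real_inner_comm, EuclideanSpace.inner_single_left]
      simp [stochGrad]
    rw [h1]
    refine (hℓ.differentiable p.2 p.1).hasFDerivAt.lim _ ?_
    simpa using tendsto_natCast_atTop_atTop (R := ℝ)

/-- Integrating a function of a past quantity and a fresh sample: the sample can be integrated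
out first. -/
theorem IsSampling.lintegral_eq {Ω Ξ E : Type*} [mΩ : MeasurableSpace Ω] [MeasurableSpace Ξ]
    [MeasurableSpace E] {P : Measure Ω} [IsProbabilityMeasure P] {D : Measure Ξ}
    [IsProbabilityMeasure D] {ℱ : Filtration ℕ mΩ} {ξ : ℕ → Ω → Ξ} (h : IsSampling P D ℱ ξ) {t : ℕ}
    {Z : Ω → E} (hZ : Measurable[ℱ t] Z) {ψ : E × Ξ → ENNReal} (hψ : Measurable ψ) :
    ∫⁻ ω, ψ (Z ω, ξ (t + 1) ω) ∂P = ∫⁻ ω, ∫⁻ z, ψ (Z ω, z) ∂D ∂P := by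
  have hZ' : Measurable Z := hZ.mono (ℱ.le t) le_rfl
  have hξ : Measurable (ξ (t + 1)) := (h.adapted (t + 1) (by omega)).mono (ℱ.le _) le_rfl
  have hind : IndepFun Z (ξ (t + 1)) P := by
    rw [IndepFun_iff_Indep]
    exact indep_of_indep_of_le_left (h.indep t).symm hZ.comap_le
  have hmap := (indepFun_iff_map_prod_eq_prod_map_map hZ'.aemeasurable hξ.aemeasurable).1 hind
  rw [h.law (t + 1) (by omega)] at hmap
  calc ∫⁻ ω, ψ (Z ω, ξ (t + 1) ω) ∂P
      = ∫⁻ p, ψ p ∂(P.map fun ω => (Z ω, ξ (t + 1) ω)) :=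
        (lintegral_map hψ (hZ'.prodMk hξ)).symm
    _ = ∫⁻ x, ∫⁻ z, ψ (x, z) ∂D ∂(P.map Z) := by
        rw [hmap, lintegral_prod _ hψ.aemeasurable]
    _ = ∫⁻ ω, ∫⁻ z, ψ (Z ω, z) ∂D ∂P := lintegral_map hψ.lintegral_prod_right' hZ'

/-- The second moment of `u + α N`, for gradient noise `N` at a fixed parameter: the cross term
vanishes since the noise is centred. -/
theorem HasBoundedVariance.integral_norm_add_sq_le {m n : ℕ} {Ξ : Type*} [MeasurableSpace Ξ]
    {D : Measure Ξ} [IsProbabilityMeasure D] {ℓ : MatSpace m n → Ξ → ℝ} {σ : ℝ}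
    (hV : HasBoundedVariance D ℓ σ) (x u : MatSpace m n) (α : ℝ) :
    Integrable (fun z => ‖u + α • (stochGrad ℓ x z - ∇ (objective D ℓ) x)‖ ^ 2) D ∧
    ∫ z, ‖u + α • (stochGrad ℓ x z - ∇ (objective D ℓ) x)‖ ^ 2 ∂D
      ≤ ‖u‖ ^ 2 + α ^ 2 * σ ^ 2 := by
  set N : Ξ → MatSpace m n := fun z => stochGrad ℓ x z - ∇ (objective D ℓ) x with hN
  have hNi : Integrable N D := (hV.integrable x).sub (integrable_const _)
  have hN0 : ∫ z, N z ∂D = 0 := by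
    rw [hN, integral_sub (hV.integrable x) (integrable_const _), hV.unbiased x]
    simp
  have hexp : ∀ z, ‖u + α • N z‖ ^ 2 = ‖u‖ ^ 2 + (2 * α) * inner ℝ u (N z) + α ^ 2 * ‖N z‖ ^ 2 := by
    intro z
    rw [norm_add_sq_real, real_inner_smul_right, norm_smul, mul_pow, Real.norm_eq_abs, sq_abs]
    ring
  have hi1 : Integrable (fun z => inner ℝ u (N z)) D := hNi.const_inner u
  have hi2 : Integrable (fun z => ‖N z‖ ^ 2) D := hV.integrable_sq x
  have hi3 : Integrable (fun z => ‖u‖ ^ 2 + (2 * α) * inner ℝ u (N z)) D :=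
    (integrable_const _).add (hi1.const_mul _)
  change Integrable (fun z => ‖u + α • N z‖ ^ 2) D ∧ ∫ z, ‖u + α • N z‖ ^ 2 ∂D ≤ _
  simp only [hexp]
  refine ⟨hi3.add (hi2.const_mul _), ?_⟩
  rw [integral_add hi3 (hi2.const_mul _), integral_add (integrable_const _) (hi1.const_mul _),
    integral_const_mul, integral_const_mul, integral_inner hNi, hN0, inner_zero_right]
  simp only [integral_const, probReal_univ, one_mul, mul_zero, add_zero, smul_eq_mul]
  gcongr
  exact hV.variance_le x

/-- Weighted second moments of `u + α N` and `N` at a fresh sample, where the weight `y`, the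
vector `u` and the parameter `x` are known in advance. -/
theorem lintegral_mul_one_add_norm_sq_le {m n : ℕ} {Ω Ξ : Type*} [mΩ : MeasurableSpace Ω]
    [MeasurableSpace Ξ] {P : Measure Ω} [IsProbabilityMeasure P] {D : Measure Ξ}
    [IsProbabilityMeasure D] {ℱ : Filtration ℕ mΩ} {ξ : ℕ → Ω → Ξ} (hS : IsSampling P D ℱ ξ)
    {ℓ : MatSpace m n → Ξ → ℝ} {σ : ℝ} (hℓ : IsSampleLoss D ℓ) (hV : HasBoundedVariance D ℓ σ)
    (hgrad : Continuous (∇ (objective D ℓ))) {t : ℕ} {x u : Ω → MatSpace m n} {y : Ω → ℝ}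
    (hx : Measurable[ℱ t] x) (hu : Measurable[ℱ t] u) (hy : Measurable[ℱ t] y)
    (hy0 : ∀ ω, 0 ≤ y ω) (α : ℝ) {A B C : ℝ} (hA : 0 ≤ A) (hB : 0 ≤ B) (hC : 0 ≤ C) :
    ∫⁻ ω, ENNReal.ofReal (y ω * (A + B *
        ‖u ω + α • (stochGrad ℓ (x ω) (ξ (t + 1) ω) - ∇ (objective D ℓ) (x ω))‖ ^ 2
        + C * ‖stochGrad ℓ (x ω) (ξ (t + 1) ω) - ∇ (objective D ℓ) (x ω)‖ ^ 2)) ∂P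
      ≤ ∫⁻ ω, ENNReal.ofReal (y ω * (A + B * (‖u ω‖ ^ 2 + α ^ 2 * σ ^ 2) + C * σ ^ 2)) ∂P := by
  let ψ : (MatSpace m n × MatSpace m n × ℝ) × Ξ → ENNReal := fun p =>
    ENNReal.ofReal (p.1.2.2 * (A + B *
        ‖p.1.2.1 + α • (stochGrad ℓ p.1.1 p.2 - ∇ (objective D ℓ) p.1.1)‖ ^ 2
        + C * ‖stochGrad ℓ p.1.1 p.2 - ∇ (objective D ℓ) p.1.1‖ ^ 2))
  have hψ : Measurable ψ := by
    have h1 : Measurable fun p : (MatSpace m n × MatSpace m n × ℝ) × Ξ =>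
        stochGrad ℓ p.1.1 p.2 :=
      hℓ.measurable_stochGrad.comp (measurable_fst.fst.prodMk measurable_snd)
    have h2 : Measurable fun p : (MatSpace m n × MatSpace m n × ℝ) × Ξ =>
        ∇ (objective D ℓ) p.1.1 := hgrad.measurable.comp measurable_fst.fst
    have h3 : Measurable fun p : (MatSpace m n × MatSpace m n × ℝ) × Ξ => p.1.2.1 :=
      measurable_fst.snd.fst
    have h4 : Measurable fun p : (MatSpace m n × MatSpace m n × ℝ) × Ξ => p.1.2.2 :=
      measurable_fst.snd.snd
    exact (h4.mul (((((h3.add ((h1.sub h2).const_smul α)).norm.pow_const 2).const_mul B).const_add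
      A).add (((h1.sub h2).norm.pow_const 2).const_mul C))).ennreal_ofReal
  refine (hS.lintegral_eq (hx.prodMk (hu.prodMk hy)) hψ).trans_le (lintegral_mono fun ω => ?_)
  obtain ⟨hi1, hle1⟩ := hV.integral_norm_add_sq_le (x ω) (u ω) α
  have hi2 := hV.integrable_sq (x ω)
  have hle2 := hV.variance_le (x ω)
  have hi3 : Integrable (fun z => A + B *
      ‖u ω + α • (stochGrad ℓ (x ω) z - ∇ (objective D ℓ) (x ω))‖ ^ 2) D :=
    (integrable_const A).add (hi1.const_mul B)
  have hi4 : Integrable (fun z => y ω * (A + B *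
        ‖u ω + α • (stochGrad ℓ (x ω) z - ∇ (objective D ℓ) (x ω))‖ ^ 2
        + C * ‖stochGrad ℓ (x ω) z - ∇ (objective D ℓ) (x ω)‖ ^ 2)) D :=
    (hi3.add (hi2.const_mul C)).const_mul (y ω)
  simp only [ψ]
  rw [← ofReal_integral_eq_lintegral_ofReal hi4
    (Filter.Eventually.of_forall fun z => mul_nonneg (hy0 ω) (by positivity))]
  refine ENNReal.ofReal_le_ofReal ?_
  rw [integral_const_mul, integral_add hi3 (hi2.const_mul C), integral_add (integrable_const _)
    (hi1.const_mul B), integral_const_mul, integral_const_mul, integral_const, probReal_univ,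
    one_smul]
  refine mul_le_mul_of_nonneg_left ?_ (hy0 ω)
  gcongr

/-! ### Step sizes and momentum parameters -/

/-- The properties of the two parameter options that the convergence proof uses. The last two
concern the coefficient of the fresh noise in the recursion for `shiftedError`. -/
structure IsMuonSchedule (η β γ : ℕ → ℝ) : Prop where
  step : ∀ t : ℕ, 1 ≤ t → η t = (t : ℝ) ^ (-(3 / 4) : ℝ)
  momentum_nonneg : ∀ t : ℕ, 1 ≤ t → 0 ≤ β t
  momentum_le : ∀ t : ℕ, 1 ≤ t → β t ≤ 1 - (√((t : ℝ) + 1))⁻¹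
  reduction_nonneg : ∀ t : ℕ, 1 ≤ t → 0 ≤ γ t
  reduction_le : ∀ t : ℕ, 1 ≤ t → γ t ≤ (√(t : ℝ))⁻¹
  noise_nonneg : ∀ t : ℕ, 1 ≤ t → 0 ≤ 1 - β t + γ t * β t - γ (t + 1)
  noise_le : ∀ t : ℕ, 1 ≤ t → 1 - β t + γ t * β t - γ (t + 1) ≤ (√(t : ℝ))⁻¹

theorem isMuonSchedule_of_options {η β γ : ℕ → ℝ}
    (hη : ∀ t : ℕ, 1 ≤ t → η t = (t : ℝ) ^ (-(3 / 4) : ℝ))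
    (h : (∀ t : ℕ, 1 ≤ t → γ t = 0 ∧ β t = 1 - (t : ℝ) ^ (-(1 / 2) : ℝ)) ∨
      (∀ t : ℕ, 1 ≤ t → γ t = (t : ℝ) ^ (-(1 / 2) : ℝ) ∧
        β t = 1 - ((t : ℝ) + 1) ^ (-(1 / 2) : ℝ))) : IsMuonSchedule η β γ := by
  have hpow : ∀ x : ℝ, 0 ≤ x → x ^ (-(1 / 2) : ℝ) = (√x)⁻¹ := fun x hx => by
    rw [Real.rpow_neg hx, Real.sqrt_eq_rpow]
  have hle1 : ∀ t : ℕ, 1 ≤ t → (√(t : ℝ))⁻¹ ≤ 1 := fun t ht =>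
    inv_le_one_of_one_le₀ (Real.one_le_sqrt.2 (by exact_mod_cast ht))
  have hpos : ∀ t : ℕ, 1 ≤ t → 0 < √(t : ℝ) := fun t ht =>
    Real.sqrt_pos.2 (by exact_mod_cast ht)
  have hanti : ∀ t : ℕ, 1 ≤ t → (√((t : ℝ) + 1))⁻¹ ≤ (√(t : ℝ))⁻¹ := fun t ht =>
    inv_anti₀ (hpos t ht) (Real.sqrt_le_sqrt (by linarith))
  have hnn : ∀ t : ℕ, 0 ≤ (√(t : ℝ))⁻¹ := fun t => by positivity
  rcases h with h | h
  · have hγ : ∀ t : ℕ, 1 ≤ t → γ t = 0 := fun t ht => (h t ht).1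
    have hβ : ∀ t : ℕ, 1 ≤ t → β t = 1 - (√(t : ℝ))⁻¹ := fun t ht => by
      rw [(h t ht).2, hpow _ (Nat.cast_nonneg t)]
    refine ⟨hη, fun t ht => ?_, fun t ht => ?_, fun t ht => (hγ t ht).ge, fun t ht => ?_,
      fun t ht => ?_, fun t ht => ?_⟩
    · rw [hβ t ht]; linarith [hle1 t ht]
    · rw [hβ t ht]; linarith [hanti t ht]
    · rw [hγ t ht]; exact hnn t
    · rw [hγ t ht, hγ (t + 1) (by omega), hβ t ht]; linarith [hnn t]
    · rw [hγ t ht, hγ (t + 1) (by omega), hβ t ht]; linarith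
  · have hγ : ∀ t : ℕ, 1 ≤ t → γ t = (√(t : ℝ))⁻¹ := fun t ht => by
      rw [(h t ht).1, hpow _ (Nat.cast_nonneg t)]
    have hβ : ∀ t : ℕ, 1 ≤ t → β t = 1 - (√((t : ℝ) + 1))⁻¹ := fun t ht => by
      rw [(h t ht).2, hpow _ (by positivity)]
    have hβ0 : ∀ t : ℕ, 1 ≤ t → 0 ≤ β t := fun t ht => by
      rw [hβ t ht]; linarith [hanti t ht, hle1 t ht]
    have hα : ∀ t : ℕ, 1 ≤ t → 1 - β t + γ t * β t - γ (t + 1) = (√(t : ℝ))⁻¹ * β t :=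
      fun t ht => by
        have hγ' := hγ (t + 1) (by omega)
        push_cast at hγ'
        rw [hγ', hγ t ht, hβ t ht]; ring
    refine ⟨hη, hβ0, fun t ht => (hβ t ht).le, fun t ht => ?_, fun t ht => (hγ t ht).le,
      fun t ht => ?_, fun t ht => ?_⟩
    · rw [hγ t ht]; exact hnn t
    · rw [hα t ht]; exact mul_nonneg (hnn t) (hβ0 t ht)
    · rw [hα t ht]
      refine mul_le_of_le_one_right (hnn t) ?_
      rw [hβ t ht]
      have : 0 ≤ (√((t : ℝ) + 1))⁻¹ := by positivity
      linarith

theorem rpow_quarter_pow (t : ℕ) : ((t : ℝ) ^ (1 / 4 : ℝ)) ^ 4 = t := by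
  rw [← Real.rpow_natCast, ← Real.rpow_mul (Nat.cast_nonneg t)]
  norm_num

namespace IsMuonSchedule

variable {η β γ : ℕ → ℝ}

theorem step_eq (h : IsMuonSchedule η β γ) {t : ℕ} (ht : 1 ≤ t) :
    η t = 1 / ((t : ℝ) ^ (1 / 4 : ℝ)) ^ 3 := by
  rw [h.step t ht, Real.rpow_neg (Nat.cast_nonneg t), ← Real.rpow_natCast,
    ← Real.rpow_mul (Nat.cast_nonneg t), one_div]
  norm_num

theorem step_nonneg (h : IsMuonSchedule η β γ) {t : ℕ} (ht : 1 ≤ t) : 0 ≤ η t := by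
  rw [h.step_eq ht]; positivity

/-- The step sizes sum up to a multiple of `t ^ (1 / 4)`, in telescoping form. -/
theorem step_le_sub (h : IsMuonSchedule η β γ) {t : ℕ} (ht : 1 ≤ t) :
    η t ≤ 8 * ((t + 1 : ℕ) : ℝ) ^ (1 / 4 : ℝ) - 8 * (t : ℝ) ^ (1 / 4 : ℝ) := by
  have ht' : (1 : ℝ) ≤ t := by exact_mod_cast ht
  have hx4 := rpow_quarter_pow t
  have hy4 := rpow_quarter_pow (t + 1)
  rw [h.step_eq ht]
  have hx : 0 < (t : ℝ) ^ (1 / 4 : ℝ) := Real.rpow_pos_of_pos (by linarith) _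
  have hy : 0 < ((t + 1 : ℕ) : ℝ) ^ (1 / 4 : ℝ) := Real.rpow_pos_of_pos (by positivity) _
  set x := (t : ℝ) ^ (1 / 4 : ℝ)
  set y := ((t + 1 : ℕ) : ℝ) ^ (1 / 4 : ℝ)
  push_cast at hy4
  have hyx : y ≤ 6 / 5 * x := by
    refine le_of_pow_le_pow_left₀ (n := 4) (by norm_num) (by positivity) ?_
    rw [mul_pow, hy4, hx4]
    linarith
  have hxy : x ≤ y := by
    refine le_of_pow_le_pow_left₀ (n := 4) (by norm_num) hy.le ?_
    rw [hy4, hx4]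
    linarith
  rw [div_le_iff₀ (by positivity)]
  have h1 : (y - x) * ((y + x) * (y ^ 2 + x ^ 2)) = 1 := by
    linear_combination hy4 - hx4
  have h2 : (y + x) * (y ^ 2 + x ^ 2) ≤ 8 * x ^ 3 := by
    have h3 : y ^ 2 ≤ (6 / 5 * x) ^ 2 := by gcongr
    calc (y + x) * (y ^ 2 + x ^ 2) ≤ (6 / 5 * x + x) * ((6 / 5 * x) ^ 2 + x ^ 2) := by gcongr
      _ = 671 / 125 * x ^ 3 := by ring
      _ ≤ 8 * x ^ 3 := by gcongr; norm_num
  nlinarith [mul_le_mul_of_nonneg_left h2 (sub_nonneg.2 hxy)]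

theorem noise_sq_le (h : IsMuonSchedule η β γ) {t : ℕ} (ht : 1 ≤ t) :
    (1 - β t + γ t * β t - γ (t + 1)) ^ 2 ≤ 1 / t := by
  calc _ ≤ ((√(t : ℝ))⁻¹) ^ 2 := pow_le_pow_left₀ (h.noise_nonneg t ht) (h.noise_le t ht) 2
    _ = 1 / t := by rw [inv_pow, Real.sq_sqrt (Nat.cast_nonneg t), one_div]

theorem reduction_sq_le (h : IsMuonSchedule η β γ) {t : ℕ} (ht : 1 ≤ t) : γ t ^ 2 ≤ 1 / t := by
  calc _ ≤ ((√(t : ℝ))⁻¹) ^ 2 :=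
        pow_le_pow_left₀ (h.reduction_nonneg t ht) (h.reduction_le t ht) 2
    _ = 1 / t := by rw [inv_pow, Real.sq_sqrt (Nat.cast_nonneg t), one_div]

theorem reduction_le_one (h : IsMuonSchedule η β γ) {t : ℕ} (ht : 1 ≤ t) : γ t ≤ 1 :=
  (h.reduction_le t ht).trans
    (inv_le_one_of_one_le₀ (Real.one_le_sqrt.2 (by exact_mod_cast ht)))

theorem momentum_le_one (h : IsMuonSchedule η β γ) {t : ℕ} (ht : 1 ≤ t) : β t ≤ 1 := by
  have h1 := h.momentum_le t ht
  have : 0 ≤ (√((t : ℝ) + 1))⁻¹ := by positivity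
  linarith

/-- An error `s` that contracts by the factor `β` and receives a new error of the size of a step:
by convexity the cross term costs only the factor `1 / (1 - β)` on the square of the new error,
and that factor is of order `√t`. -/
theorem momentum_avg_sq_le (h : IsMuonSchedule η β γ) {t : ℕ} (ht : 1 ≤ t) (s e : ℝ) :
    (β (t + 1) * s + e * η t) ^ 2 ≤ β (t + 1) * s ^ 2 + 2 * e ^ 2 / t := by
  have ht' : (1 : ℝ) ≤ t := by exact_mod_cast ht
  have hβ0 := h.momentum_nonneg (t + 1) (by omega)
  have hβ1 := h.momentum_le (t + 1) (by omega)
  push_cast at hβ1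
  set b := β (t + 1)
  set z := √((t : ℝ) + 1 + 1) with hz
  have hz0 : 0 < z := Real.sqrt_pos.2 (by positivity)
  have hz2 : z ^ 2 = t + 2 := by rw [hz, Real.sq_sqrt (by positivity)]; ring
  have hb : 0 < 1 - b := by
    have : 0 < z⁻¹ := by positivity
    linarith
  have h1 : (b * s + e * η t) ^ 2 ≤ b * s ^ 2 + (e * η t) ^ 2 / (1 - b) := by
    have h2 : b * s ^ 2 + (e * η t) ^ 2 / (1 - b) - (b * s + e * η t) ^ 2
        = b / (1 - b) * ((1 - b) * s - e * η t) ^ 2 := by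
      field_simp
      ring
    have h3 : 0 ≤ b / (1 - b) * ((1 - b) * s - e * η t) ^ 2 := by positivity
    linarith
  have h2 : (e * η t) ^ 2 / (1 - b) ≤ (e * η t) ^ 2 * z := by
    rw [div_eq_mul_inv]
    gcongr
    rw [inv_le_comm₀ hb hz0]
    linarith
  have h3 : η t ^ 2 * z ≤ 2 / t := by
    have hx4 := rpow_quarter_pow t
    rw [h.step_eq ht]
    have hx : 0 < (t : ℝ) ^ (1 / 4 : ℝ) := Real.rpow_pos_of_pos (by linarith) _
    set x := (t : ℝ) ^ (1 / 4 : ℝ)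
    have hzx : z ≤ 2 * x ^ 2 := by
      refine le_of_pow_le_pow_left₀ (n := 2) (by norm_num) (by positivity) ?_
      rw [hz2]
      nlinarith
    rw [← hx4]
    calc (1 / x ^ 3) ^ 2 * z ≤ (1 / x ^ 3) ^ 2 * (2 * x ^ 2) := by gcongr
      _ = 2 / x ^ 4 := by field_simp
  calc _ ≤ b * s ^ 2 + (e * η t) ^ 2 * z := h1.trans (by gcongr)
    _ = b * s ^ 2 + e ^ 2 * (η t ^ 2 * z) := by ring
    _ ≤ b * s ^ 2 + e ^ 2 * (2 / t) := by gcongr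
    _ = _ := by ring

end IsMuonSchedule

/-! ### The error recursion -/

/-- The noise `∇f(X_t; ξ_t) - ∇f(X_t)` of the stochastic gradient at step `t ≥ 1`. -/
noncomputable def gradNoise {m n : ℕ} {Ω Ξ : Type*} [MeasurableSpace Ξ] (D : Measure Ξ)
    (ℓ : MatSpace m n → Ξ → ℝ) (ξ : ℕ → Ω → Ξ) (X : ℕ → Ω → MatSpace m n) (t : ℕ) (ω : Ω) :
    MatSpace m n :=
  stochGrad ℓ (X t ω) (ξ t ω) - ∇ (objective D ℓ) (X t ω)

/-- The momentum error `M_t - ∇f(X_t)` without the share `γ_{t+1}` of the current noise, which the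
correction term of the next momentum update removes. -/
noncomputable def shiftedError {m n : ℕ} {Ω Ξ : Type*} [MeasurableSpace Ξ] (D : Measure Ξ)
    (ℓ : MatSpace m n → Ξ → ℝ) (ξ : ℕ → Ω → Ξ) (γ : ℕ → ℝ) (X M : ℕ → Ω → MatSpace m n) (t : ℕ)
    (ω : Ω) : MatSpace m n :=
  M t ω - ∇ (objective D ℓ) (X t ω) - γ (t + 1) • gradNoise D ℓ ξ X t ω

/-- The part of `shiftedError` at time `t + 1` that is known at time `t`. -/
noncomputable def predictedError {m n : ℕ} {Ω Ξ : Type*} [MeasurableSpace Ξ] (D : Measure Ξ)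
    (ℓ : MatSpace m n → Ξ → ℝ) (ξ : ℕ → Ω → Ξ) (β γ : ℕ → ℝ) (X M : ℕ → Ω → MatSpace m n) (t : ℕ)
    (ω : Ω) : MatSpace m n :=
  β (t + 1) • shiftedError D ℓ ξ γ X M t ω + (β (t + 1) * (1 - γ (t + 1))) •
    (∇ (objective D ℓ) (X t ω) - ∇ (objective D ℓ) (X (t + 1) ω))

/-- A run of the algorithm under the assumptions of the convergence theorem. -/
structure IsMuonPLRun {m n : ℕ} {Ξ Ω : Type*} [MeasurableSpace Ξ] (D : Measure Ξ)
    (ℓ : MatSpace m n → Ξ → ℝ) (fstar L σ μ : ℝ) [MeasurableSpace Ω] (P : Measure Ω)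
    (ℱ : Filtration ℕ ‹MeasurableSpace Ω›) (ξ : ℕ → Ω → Ξ) (η β γ : ℕ → ℝ) (x₁ : MatSpace m n)
    (X M O : ℕ → Ω → MatSpace m n) : Prop where
  cols_le_rows : n ≤ m
  smoothness_pos : 0 < L
  pl_pos : 0 < μ
  loss : IsSampleLoss D ℓ
  lower : ∀ X, fstar ≤ objective D ℓ X
  smooth : IsLSmooth (objective D ℓ) L
  variance : HasBoundedVariance D ℓ σ
  sampling : IsSampling P D ℱ ξ
  schedule : IsMuonSchedule η β γ
  run : IsMuonMVR1Run ℓ ℱ ξ η β γ x₁ X M O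
  pl : ∀ t, 1 ≤ t → ∀ᵐ ω ∂P, PLAt (objective D ℓ) fstar μ (X t ω)

namespace IsMuonPLRun

variable {m n : ℕ} {Ξ Ω : Type*} [MeasurableSpace Ξ] {D : Measure Ξ}
  {ℓ : MatSpace m n → Ξ → ℝ} {fstar L σ μ : ℝ} [mΩ : MeasurableSpace Ω] {P : Measure Ω}
  {ℱ : Filtration ℕ mΩ} {ξ : ℕ → Ω → Ξ} {η β γ : ℕ → ℝ} {x₁ : MatSpace m n}
  {X M O : ℕ → Ω → MatSpace m n}

theorem continuous_gradient (h : IsMuonPLRun D ℓ fstar L σ μ P ℱ ξ η β γ x₁ X M O) :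
    Continuous (∇ (objective D ℓ)) := by
  refine LipschitzWith.continuous (K := L.toNNReal) (LipschitzWith.of_dist_le_mul fun x y => ?_)
  rw [dist_eq_norm, dist_eq_norm, Real.coe_toNNReal _ h.smoothness_pos.le]
  exact h.smooth.2 y x

theorem measurable_param (h : IsMuonPLRun D ℓ fstar L σ μ P ℱ ξ η β γ x₁ X M O) (t : ℕ) :
    Measurable[ℱ t] (X (t + 1)) := by
  induction t with
  | zero =>
    have : X (0 + 1) = fun _ => x₁ := funext h.run.init_param
    rw [this]
    exact measurable_const
  | succ t ih =>
    have : X (t + 1 + 1) = fun ω => X (t + 1) ω - η (t + 1) • O (t + 1) ω :=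
      funext (h.run.step (t + 1) (by omega))
    rw [this]
    exact (ih.mono (ℱ.mono (by omega)) le_rfl).sub
      ((h.run.direction_adapted (t + 1) (by omega)).const_smul (η (t + 1)))

theorem measurable_gradNoise (h : IsMuonPLRun D ℓ fstar L σ μ P ℱ ξ η β γ x₁ X M O) (t : ℕ) :
    Measurable[ℱ (t + 1)] (gradNoise D ℓ ξ X (t + 1)) := by
  have hX : Measurable[ℱ (t + 1)] (X (t + 1)) :=
    (h.measurable_param t).mono (ℱ.mono (by omega)) le_rfl
  exact (h.loss.measurable_stochGrad.comp
    (hX.prodMk (h.sampling.adapted (t + 1) (by omega)))).sub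
      (h.continuous_gradient.measurable.comp hX)

theorem measurable_gradAt (h : IsMuonPLRun D ℓ fstar L σ μ P ℱ ξ η β γ x₁ X M O) (t : ℕ) :
    Measurable[ℱ t] (gradAt ℓ ξ X t) := by
  cases t with
  | zero =>
    have : gradAt ℓ ξ X 0 = fun _ => 0 := by funext ω; simp [gradAt]
    rw [this]
    exact measurable_const
  | succ t =>
    have hX : Measurable[ℱ (t + 1)] (X (t + 1)) :=
      (h.measurable_param t).mono (ℱ.mono (by omega)) le_rfl
    have : gradAt ℓ ξ X (t + 1) = fun ω => stochGrad ℓ (X (t + 1) ω) (ξ (t + 1) ω) := by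
      funext ω; simp [gradAt]
    rw [this]
    exact h.loss.measurable_stochGrad.comp
      (hX.prodMk (h.sampling.adapted (t + 1) (by omega)))

theorem measurable_momentum (h : IsMuonPLRun D ℓ fstar L σ μ P ℱ ξ η β γ x₁ X M O) (t : ℕ) :
    Measurable[ℱ t] (M t) := by
  induction t with
  | zero =>
    have : M 0 = fun _ => 0 := funext h.run.init_momentum
    rw [this]
    exact measurable_const
  | succ t ih =>
    rw [funext (h.run.momentum t)]
    have h1 := h.measurable_gradAt (t + 1)
    have h2 : Measurable[ℱ (t + 1)] (gradAt ℓ ξ X t) :=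
      (h.measurable_gradAt t).mono (ℱ.mono (by omega)) le_rfl
    have h3 : Measurable[ℱ (t + 1)] (M t) := ih.mono (ℱ.mono (by omega)) le_rfl
    exact ((h3.const_smul (β (t + 1))).add (h1.const_smul (1 - β (t + 1)))).add
      ((h1.sub h2).const_smul (γ (t + 1) * β (t + 1)))

theorem measurable_shiftedError (h : IsMuonPLRun D ℓ fstar L σ μ P ℱ ξ η β γ x₁ X M O) {t : ℕ}
    (ht : 1 ≤ t) : Measurable[ℱ t] (shiftedError D ℓ ξ γ X M t) := by
  obtain ⟨t, rfl⟩ := Nat.exists_eq_add_of_le' ht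
  have hX : Measurable[ℱ (t + 1)] (X (t + 1)) :=
    (h.measurable_param t).mono (ℱ.mono (by omega)) le_rfl
  exact ((h.measurable_momentum (t + 1)).sub (h.continuous_gradient.measurable.comp hX)).sub
    ((h.measurable_gradNoise t).const_smul (γ (t + 1 + 1)))

theorem measurable_predictedError (h : IsMuonPLRun D ℓ fstar L σ μ P ℱ ξ η β γ x₁ X M O) {t : ℕ}
    (ht : 1 ≤ t) : Measurable[ℱ t] (predictedError D ℓ ξ β γ X M t) := by
  have h1 := h.measurable_shiftedError ht
  have h2 := h.measurable_param t
  obtain ⟨t, rfl⟩ := Nat.exists_eq_add_of_le' ht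
  have hX : Measurable[ℱ (t + 1)] (X (t + 1)) :=
    (h.measurable_param t).mono (ℱ.mono (by omega)) le_rfl
  exact (h1.const_smul (β (t + 1 + 1))).add
    (((h.continuous_gradient.measurable.comp hX).sub
      (h.continuous_gradient.measurable.comp h2)).const_smul
        (β (t + 1 + 1) * (1 - γ (t + 1 + 1))))

/-- The shift by `γ_{t+1} N_t` turns the momentum recursion into one driven by fresh noise only. -/
theorem shiftedError_succ (h : IsMuonPLRun D ℓ fstar L σ μ P ℱ ξ η β γ x₁ X M O) {t : ℕ}
    (ht : 1 ≤ t) (ω : Ω) :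
    shiftedError D ℓ ξ γ X M (t + 1) ω = predictedError D ℓ ξ β γ X M t ω
      + (1 - β (t + 1) + γ (t + 1) * β (t + 1) - γ (t + 1 + 1)) • gradNoise D ℓ ξ X (t + 1) ω := by
  have hg : ∀ s, 1 ≤ s → gradAt ℓ ξ X s ω
      = gradNoise D ℓ ξ X s ω + ∇ (objective D ℓ) (X s ω) := by
    intro s hs
    rw [gradAt, if_neg (by omega), gradNoise]
    abel
  rw [predictedError, shiftedError, shiftedError, h.run.momentum t ω, hg t ht,
    hg (t + 1) (by omega)]
  module

theorem norm_direction_le (h : IsMuonPLRun D ℓ fstar L σ μ P ℱ ξ η β γ x₁ X M O) {t : ℕ}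
    (ht : 1 ≤ t) (ω : Ω) : ‖O t ω‖ ≤ (n : ℝ) + 1 :=
  (h.run.direction t ht ω).norm_le

theorem norm_predictedError_sq_le (h : IsMuonPLRun D ℓ fstar L σ μ P ℱ ξ η β γ x₁ X M O) {t : ℕ}
    (ht : 1 ≤ t) (ω : Ω) :
    ‖predictedError D ℓ ξ β γ X M t ω‖ ^ 2 ≤ β (t + 1) * ‖shiftedError D ℓ ξ γ X M t ω‖ ^ 2
      + 2 * (L * ((n : ℝ) + 1)) ^ 2 / t := by
  refine le_trans ?_ (h.schedule.momentum_avg_sq_le ht _ _)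
  have hβ0 := h.schedule.momentum_nonneg (t + 1) (by omega)
  have hβ1 := h.schedule.momentum_le_one (t := t + 1) (by omega)
  have hγ0 := h.schedule.reduction_nonneg (t + 1) (by omega)
  have hγ1 := h.schedule.reduction_le_one (t := t + 1) (by omega)
  have hη := h.schedule.step_nonneg ht
  have hL := h.smoothness_pos
  have hgrad : ‖∇ (objective D ℓ) (X t ω) - ∇ (objective D ℓ) (X (t + 1) ω)‖
      ≤ L * ((n : ℝ) + 1) * η t := by
    refine (h.smooth.2 _ _).trans ?_
    rw [h.run.step t ht ω, sub_sub_cancel, norm_smul, Real.norm_of_nonneg hη]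
    calc L * (η t * ‖O t ω‖) ≤ L * (η t * ((n : ℝ) + 1)) := by
          gcongr
          exact h.norm_direction_le ht ω
      _ = _ := by ring
  refine pow_le_pow_left₀ (norm_nonneg _) ?_ 2
  refine (norm_add_le _ _).trans ?_
  rw [norm_smul, norm_smul, Real.norm_of_nonneg hβ0,
    Real.norm_of_nonneg (mul_nonneg hβ0 (by linarith))]
  refine add_le_add le_rfl ?_
  have h1 : β (t + 1) * (1 - γ (t + 1)) ≤ 1 := by nlinarith
  calc _ ≤ 1 * ‖∇ (objective D ℓ) (X t ω) - ∇ (objective D ℓ) (X (t + 1) ω)‖ := by gcongr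
    _ ≤ _ := by rw [one_mul]; exact hgrad

end IsMuonPLRun

/-! ### Drift of the Lyapunov function along a run -/

/-- Constants for the Lyapunov function on the window `δ ^ 4 * T ≤ t ≤ T`: `ℓ` is the exponent and
`ρ` the decay rate, `r` scales the squared momentum error, and above the level `a₀` a squared
error of at most `k` times the squared level does not prevent the decrease. They depend only on
`L`, `σ`, the bound `d` for the directions and the rate `θ`. -/
structure DriftConstants (L σ d θ : ℝ) where
  (δ ℓ ρ r k a₀ : ℝ)
  δ_pos : 0 < δ
  δ_le : δ ≤ 1 / 2
  ℓ_pos : 0 < ℓ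
  ρ_pos : 0 < ρ
  r_pos : 0 < r
  k_pos : 0 < k
  a₀_pos : 0 < a₀
  ρ_le : ρ ≤ 1 / 32
  decrease : ℓ * (θ / 4) = 2 * ρ
  growth : ℓ * (d * √(L / 2) / δ ^ 3) ≤ 1 / 16
  noise : 2 * (L * d) ^ 2 + 2 * σ ^ 2 ≤ ρ * r * δ ^ 4
  error : 2 * r * k ≤ (θ / (2 * d)) ^ 2 * δ ^ 4
  one_le : 1 ≤ k * a₀ ^ 2
  level : (L * d ^ 2 / θ + θ) / δ ^ 3 ≤ a₀
  start : 16 * (d * √(L / 2)) * δ * ℓ ≤ ρ / 4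

/-- The length `δ ^ 4` of the initial segment is fixed first, through a bound on `δ` in terms of
`θ` and `d √(L/2)` only; the exponent `ℓ` is chosen after `δ`, and cancels in `start`. -/
theorem nonempty_driftConstants {L d θ : ℝ} (σ : ℝ) (hL : 0 < L) (hd : 0 < d) (hθ : 0 < θ) :
    Nonempty (DriftConstants L σ d θ) := by
  set C₀ := d * √(L / 2) with hC₀
  have hC : 0 < C₀ := mul_pos hd (Real.sqrt_pos.2 (by positivity))
  obtain ⟨δ, hδ, hδ1, hδ2⟩ : ∃ δ : ℝ, 0 < δ ∧ δ ≤ 1 / 2 ∧ δ * (512 * C₀) ≤ θ :=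
    ⟨min (1 / 2) (θ / (512 * C₀)), by positivity, min_le_left _ _, by
      rw [← le_div_iff₀ (by positivity)]; exact min_le_right _ _⟩
  obtain ⟨ℓ, hℓ, hℓ1, hℓ2⟩ : ∃ ℓ : ℝ, 0 < ℓ ∧ ℓ * θ ≤ 1 / 4 ∧ ℓ * (C₀ / δ ^ 3) ≤ 1 / 16 := by
    refine ⟨1 / (4 * θ + 16 * (C₀ / δ ^ 3)), by positivity, ?_, ?_⟩
    · rw [div_mul_eq_mul_div, div_le_iff₀ (by positivity)]
      have : 0 < C₀ / δ ^ 3 := by positivity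
      linarith
    · rw [div_mul_eq_mul_div, div_le_iff₀ (by positivity)]
      linarith
  set ρ := ℓ * θ / 8 with hρ
  have hρ0 : 0 < ρ := by positivity
  set r := (2 * (L * d) ^ 2 + 2 * σ ^ 2) / (ρ * δ ^ 4) with hr
  have hr0 : 0 < r := by positivity
  set k := (θ / (2 * d)) ^ 2 * δ ^ 4 / (2 * r) with hk
  have hk0 : 0 < k := by positivity
  have hl : 0 < (L * d ^ 2 / θ + θ) / δ ^ 3 := by positivity
  have hk1 : 0 < 1 / √k := by positivity
  refine ⟨⟨δ, ℓ, ρ, r, k, 1 / √k + (L * d ^ 2 / θ + θ) / δ ^ 3, hδ, hδ1, hℓ, hρ0, hr0, hk0,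
    by positivity, by rw [hρ]; linarith, by rw [hρ]; ring, hℓ2, ?_, ?_, ?_, by linarith, ?_⟩⟩
  · rw [hr]; apply le_of_eq; field_simp
  · rw [hk]; apply le_of_eq; field_simp
  · have h1 : (1 / √k) ^ 2 ≤ (1 / √k + (L * d ^ 2 / θ + θ) / δ ^ 3) ^ 2 :=
      pow_le_pow_left₀ hk1.le (by linarith) 2
    calc (1 : ℝ) = k * (1 / √k) ^ 2 := by rw [div_pow, Real.sq_sqrt hk0.le]; field_simp
      _ ≤ _ := by gcongr
  · have h1 : ℓ * (δ * (512 * C₀)) ≤ ℓ * θ := by gcongr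
    rw [hρ]; linarith

/-- The square root of the optimality gap of the iterate. -/
noncomputable def sqrtGap {m n : ℕ} {Ω Ξ : Type*} [MeasurableSpace Ξ] (D : Measure Ξ)
    (ℓ : MatSpace m n → Ξ → ℝ) (fstar : ℝ) (X : ℕ → Ω → MatSpace m n) (t : ℕ) (ω : Ω) : ℝ :=
  √(objective D ℓ (X t ω) - fstar)

/-- The squared momentum error, split into `shiftedError` and the current noise, in the scaling
for which it stays bounded when `q = T ^ (1 / 4)`. -/
noncomputable def scaledError {m n : ℕ} {Ω Ξ : Type*} [MeasurableSpace Ξ] (D : Measure Ξ)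
    (ℓ : MatSpace m n → Ξ → ℝ) (ξ : ℕ → Ω → Ξ) (γ : ℕ → ℝ) (X M : ℕ → Ω → MatSpace m n) (q r : ℝ)
    (t : ℕ) (ω : Ω) : ℝ :=
  q ^ 2 / r * ‖shiftedError D ℓ ξ γ X M t ω‖ ^ 2
    + 1 / (q ^ 2 * r) * ‖gradNoise D ℓ ξ X t ω‖ ^ 2

theorem scaledError_nonneg {m n : ℕ} {Ω Ξ : Type*} [MeasurableSpace Ξ] (D : Measure Ξ)
    (ℓ : MatSpace m n → Ξ → ℝ) (ξ : ℕ → Ω → Ξ) (γ : ℕ → ℝ) (X M : ℕ → Ω → MatSpace m n) (q : ℝ)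
    {r : ℝ} (hr : 0 < r) (t : ℕ) (ω : Ω) : 0 ≤ scaledError D ℓ ξ γ X M q r t ω := by
  rw [scaledError]; positivity

/-- The Lyapunov function `exp (ℓ q √(f(X_t) - f*)) (1 + scaledError)`. -/
noncomputable def lyapunov {m n : ℕ} {Ω Ξ : Type*} [MeasurableSpace Ξ] (D : Measure Ξ)
    (ℓ : MatSpace m n → Ξ → ℝ) (fstar : ℝ) (ξ : ℕ → Ω → Ξ) (γ : ℕ → ℝ)
    (X M : ℕ → Ω → MatSpace m n) {L σ d θ : ℝ} (c : DriftConstants L σ d θ) (q : ℝ) (t : ℕ)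
    (ω : Ω) : ℝ :=
  Real.exp (c.ℓ * (q * sqrtGap D ℓ fstar X t ω)) * (1 + scaledError D ℓ ξ γ X M q c.r t ω)

namespace IsMuonPLRun

variable {m n : ℕ} {Ξ Ω : Type*} [MeasurableSpace Ξ] {D : Measure Ξ}
  {ℓ : MatSpace m n → Ξ → ℝ} {fstar L σ μ : ℝ} [mΩ : MeasurableSpace Ω] {P : Measure Ω}
  {ℱ : Filtration ℕ mΩ} {ξ : ℕ → Ω → Ξ} {η β γ : ℕ → ℝ} {x₁ : MatSpace m n}
  {X M O : ℕ → Ω → MatSpace m n}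

theorem measurable_sqrtGap (h : IsMuonPLRun D ℓ fstar L σ μ P ℱ ξ η β γ x₁ X M O) (t : ℕ) :
    Measurable[ℱ t] (sqrtGap D ℓ fstar X (t + 1)) := by
  have h1 : Continuous (objective D ℓ) := h.smooth.1.continuous
  exact ((h1.measurable.comp (h.measurable_param t)).sub_const fstar).sqrt

theorem sqrtGap_succ_le (h : IsMuonPLRun D ℓ fstar L σ μ P ℱ ξ η β γ x₁ X M O) {t : ℕ}
    (ht : 1 ≤ t) (ω : Ω) : sqrtGap D ℓ fstar X (t + 1) ω
      ≤ sqrtGap D ℓ fstar X t ω + η t * (((n : ℝ) + 1) * √(L / 2)) := by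
  rw [sqrtGap, h.run.step t ht ω]
  exact h.smooth.sqrt_gap_le h.smoothness_pos h.lower (h.schedule.step_nonneg ht)
    (h.norm_direction_le ht ω)

/-- A deterministic bound on the square root of the gap. -/
theorem sqrtGap_le (h : IsMuonPLRun D ℓ fstar L σ μ P ℱ ξ η β γ x₁ X M O) {t : ℕ}
    (ht : 1 ≤ t) (ω : Ω) : sqrtGap D ℓ fstar X t ω
      ≤ √(objective D ℓ x₁ - fstar)
        + 8 * (((n : ℝ) + 1) * √(L / 2)) * (t : ℝ) ^ (1 / 4 : ℝ) := by
  induction t, ht using Nat.le_induction with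
  | base =>
    rw [sqrtGap, h.run.init_param ω]
    exact le_add_of_nonneg_right (by positivity)
  | succ t ht ih =>
    refine (h.sqrtGap_succ_le ht ω).trans ?_
    have h1 := mul_le_mul_of_nonneg_right (h.schedule.step_le_sub ht)
      (show 0 ≤ ((n : ℝ) + 1) * √(L / 2) by positivity)
    nlinarith

/-- The momentum error in terms of `scaledError`. -/
theorem norm_momentum_error_sq_le (h : IsMuonPLRun D ℓ fstar L σ μ P ℱ ξ η β γ x₁ X M O) {t : ℕ}
    {q r δ : ℝ} (hq : 0 < q) (hr : 0 < r) (hδ : 0 < δ) (hδ1 : δ ≤ 1) (ht : δ ^ 4 * q ^ 4 ≤ t)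
    (ω : Ω) :
    ‖M t ω - ∇ (objective D ℓ) (X t ω)‖ ^ 2
      ≤ 2 * r / (δ ^ 4 * q ^ 2) * scaledError D ℓ ξ γ X M q r t ω := by
  have hγ := h.schedule.reduction_sq_le (t := t + 1) (by omega)
  have heq : M t ω - ∇ (objective D ℓ) (X t ω)
      = shiftedError D ℓ ξ γ X M t ω + γ (t + 1) • gradNoise D ℓ ξ X t ω := by
    rw [shiftedError]; abel
  have hγ' : γ (t + 1) ^ 2 ≤ 1 / (δ ^ 4 * q ^ 4) := by
    refine hγ.trans (one_div_le_one_div_of_le (by positivity) ?_)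
    push_cast; linarith
  have hδ4 : δ ^ 4 ≤ 1 := pow_le_one₀ hδ.le hδ1
  rw [heq, scaledError]
  set s := ‖shiftedError D ℓ ξ γ X M t ω‖
  set ν := ‖gradNoise D ℓ ξ X t ω‖
  calc ‖shiftedError D ℓ ξ γ X M t ω + γ (t + 1) • gradNoise D ℓ ξ X t ω‖ ^ 2
      ≤ (s + |γ (t + 1)| * ν) ^ 2 := by
        refine pow_le_pow_left₀ (norm_nonneg _) ((norm_add_le _ _).trans ?_) 2
        rw [norm_smul, Real.norm_eq_abs]
    _ ≤ 2 * (s ^ 2 + (|γ (t + 1)| * ν) ^ 2) := add_sq_le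
    _ = 2 * (1 * s ^ 2 + γ (t + 1) ^ 2 * ν ^ 2) := by rw [mul_pow, sq_abs]; ring
    _ ≤ 2 * (1 / δ ^ 4 * s ^ 2 + 1 / (δ ^ 4 * q ^ 4) * ν ^ 2) := by
        gcongr
        rw [le_div_iff₀ (by positivity)]
        linarith
    _ = 2 * r / (δ ^ 4 * q ^ 2) * (q ^ 2 / r * s ^ 2 + 1 / (q ^ 2 * r) * ν ^ 2) := by
        field_simp

/-- Inside the window the step size is comparable with `T ^ (-3 / 4) = 1 / q ^ 3`. -/
theorem step_bounds (h : IsMuonPLRun D ℓ fstar L σ μ P ℱ ξ η β γ x₁ X M O) {t : ℕ} (ht : 1 ≤ t)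
    {q δ : ℝ} (hq : 0 < q) (hδ : 0 < δ) (hlow : δ ^ 4 * q ^ 4 ≤ t) (hup : (t : ℝ) ≤ q ^ 4) :
    1 / q ^ 3 ≤ η t ∧ η t ≤ 1 / (δ ^ 3 * q ^ 3) := by
  have ht' : (1 : ℝ) ≤ t := by exact_mod_cast ht
  have hx4 := rpow_quarter_pow t
  rw [h.schedule.step_eq ht]
  have hx : 0 < (t : ℝ) ^ (1 / 4 : ℝ) := Real.rpow_pos_of_pos (by linarith) _
  set x := (t : ℝ) ^ (1 / 4 : ℝ)
  have h1 : x ≤ q := le_of_pow_le_pow_left₀ (n := 4) (by norm_num) hq.le (by rw [hx4]; exact hup)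
  have h2 : δ * q ≤ x :=
    le_of_pow_le_pow_left₀ (n := 4) (by norm_num) hx.le (by rw [hx4, mul_pow]; exact hlow)
  constructor
  · gcongr
  · rw [← mul_pow]
    gcongr

/-- Pathwise drift over one step, with the conditional expectation of the error inserted. -/
theorem lyapunov_drift (h : IsMuonPLRun D ℓ fstar L σ μ P ℱ ξ η β γ x₁ X M O)
    {θ : ℝ} (hθ : θ = √(2 * μ) / (2 * ((n : ℝ) + 1))) (c : DriftConstants L σ ((n : ℝ) + 1) θ)
    {t : ℕ} (ht : 1 ≤ t) {q : ℝ} (hq : 1 ≤ q) (hlow : c.δ ^ 4 * q ^ 4 ≤ t) (hup : (t : ℝ) ≤ q ^ 4) {ω : Ω}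
    (hPL : PLAt (objective D ℓ) fstar μ (X t ω)) :
    Real.exp (c.ℓ * (q * sqrtGap D ℓ fstar X (t + 1) ω)) *
        (1 + ((1 - 1 / q ^ 2 / 2) * scaledError D ℓ ξ γ X M q c.r t ω + c.ρ * (1 / q ^ 2)))
      ≤ Real.exp (-(c.ρ * (1 / q ^ 2))) * lyapunov D ℓ fstar ξ γ X M c q t ω
        + Real.exp (c.ℓ * c.a₀) * (1 + c.k * c.a₀ ^ 2) * (1 / q ^ 2) := by
  have hq0 : 0 < q := by linarith
  have hd0 : (0 : ℝ) < (n : ℝ) + 1 := by positivity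
  have hμ0 : 0 < √(2 * μ) := Real.sqrt_pos.2 (mul_pos two_pos h.pl_pos)
  have hδ := c.δ_pos
  have hr := c.r_pos
  have hL := h.smoothness_pos
  obtain ⟨hη1, hη2⟩ := h.step_bounds ht hq0 hδ hlow hup
  have hgap0 : 0 ≤ sqrtGap D ℓ fstar X t ω := Real.sqrt_nonneg _
  have hθ0 : 0 < θ := by rw [hθ]; positivity
  refine exp_mul_one_add_drift (c := θ / 4) (C₁ := ((n : ℝ) + 1) * √(L / 2) / c.δ ^ 3)
    (by positivity) (by rw [div_le_one (by positivity)]; exact one_le_pow₀ hq) c.ℓ_pos c.decrease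
    c.ρ_pos c.ρ_le c.growth c.k_pos.le c.a₀_pos.le c.one_le (scaledError_nonneg D ℓ ξ γ X M q hr t ω) ?_ ?_
  · calc q * sqrtGap D ℓ fstar X (t + 1) ω
        ≤ q * (sqrtGap D ℓ fstar X t ω + η t * (((n : ℝ) + 1) * √(L / 2))) := by
          gcongr; exact h.sqrtGap_succ_le ht ω
      _ ≤ q * (sqrtGap D ℓ fstar X t ω
            + 1 / (c.δ ^ 3 * q ^ 3) * (((n : ℝ) + 1) * √(L / 2))) := by gcongr
      _ = q * sqrtGap D ℓ fstar X t ω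
            + ((n : ℝ) + 1) * √(L / 2) / c.δ ^ 3 * (1 / q ^ 2) := by field_simp
  · intro ha hw
    have hS : ‖M t ω - ∇ (objective D ℓ) (X t ω)‖
        ≤ θ / (2 * ((n : ℝ) + 1)) * √(objective D ℓ (X t ω) - fstar) := by
      refine le_of_pow_le_pow_left₀ (n := 2) (by norm_num) (by positivity) ?_
      refine (h.norm_momentum_error_sq_le hq0 hr hδ (c.δ_le.trans (by norm_num)) hlow ω).trans ?_
      calc 2 * c.r / (c.δ ^ 4 * q ^ 2) * scaledError D ℓ ξ γ X M q c.r t ω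
          ≤ 2 * c.r / (c.δ ^ 4 * q ^ 2) * (c.k * (q * sqrtGap D ℓ fstar X t ω) ^ 2) := by gcongr
        _ = 2 * c.r * c.k / c.δ ^ 4 * sqrtGap D ℓ fstar X t ω ^ 2 := by field_simp
        _ ≤ (θ / (2 * ((n : ℝ) + 1))) ^ 2 * sqrtGap D ℓ fstar X t ω ^ 2 := by
            gcongr
            rw [div_le_iff₀ (by positivity)]
            exact c.error
        _ = _ := by rw [mul_pow, sqrtGap]
    have hA : (L * ((n : ℝ) + 1) ^ 2 / θ + θ) * η t ≤ √(objective D ℓ (X t ω) - fstar) := by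
      calc (L * ((n : ℝ) + 1) ^ 2 / θ + θ) * η t
          ≤ (L * ((n : ℝ) + 1) ^ 2 / θ + θ) * (1 / (c.δ ^ 3 * q ^ 3)) := by gcongr
        _ = (L * ((n : ℝ) + 1) ^ 2 / θ + θ) / c.δ ^ 3 * (1 / q ^ 3) := by field_simp
        _ ≤ c.a₀ * (1 / q ^ 3) := by
            gcongr
            exact c.level
        _ ≤ q * sqrtGap D ℓ fstar X t ω * (1 / q ^ 3) := by gcongr
        _ = sqrtGap D ℓ fstar X t ω * (1 / q ^ 2) := by field_simp
        _ ≤ sqrtGap D ℓ fstar X t ω * 1 := by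
            gcongr
            rw [div_le_one (by positivity)]; exact one_le_pow₀ hq
        _ = _ := by rw [mul_one, sqrtGap]
    have hstep := h.smooth.sqrt_gap_le_sub h.smoothness_pos h.pl_pos h.lower
      (h.schedule.step_nonneg ht) (by linarith [(Nat.cast_nonneg n : (0 : ℝ) ≤ n)]) hθ
      (h.norm_direction_le ht ω) ((h.run.direction t ht ω).norm_le_inner h.cols_le_rows) hPL hS hA
    rw [← h.run.step t ht ω] at hstep
    calc q * sqrtGap D ℓ fstar X (t + 1) ω
        ≤ q * (sqrtGap D ℓ fstar X t ω - η t * (θ / 4)) := by gcongr; exact hstep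
      _ ≤ q * (sqrtGap D ℓ fstar X t ω - 1 / q ^ 3 * (θ / 4)) := by gcongr
      _ = q * sqrtGap D ℓ fstar X t ω - θ / 4 * (1 / q ^ 2) := by field_simp

/-- Drift of the expected Lyapunov function over one step of the window. -/
theorem lintegral_lyapunov_succ_le [IsProbabilityMeasure P] [IsProbabilityMeasure D]
    (h : IsMuonPLRun D ℓ fstar L σ μ P ℱ ξ η β γ x₁ X M O)
    {θ : ℝ} (hθ : θ = √(2 * μ) / (2 * ((n : ℝ) + 1))) (c : DriftConstants L σ ((n : ℝ) + 1) θ)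
    {t : ℕ} (ht : 1 ≤ t) {q : ℝ} (hq : 1 ≤ q) (hlow : c.δ ^ 4 * q ^ 4 ≤ t) (hup : (t : ℝ) ≤ q ^ 4) :
    ∫⁻ ω, ENNReal.ofReal (lyapunov D ℓ fstar ξ γ X M c q (t + 1) ω) ∂P
      ≤ ENNReal.ofReal (Real.exp (-(c.ρ * (1 / q ^ 2)))) *
          ∫⁻ ω, ENNReal.ofReal (lyapunov D ℓ fstar ξ γ X M c q t ω) ∂P
        + ENNReal.ofReal (Real.exp (c.ℓ * c.a₀) * (1 + c.k * c.a₀ ^ 2) * (1 / q ^ 2)) := by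
  have hq0 : 0 < q := by linarith
  have hr := c.r_pos
  have hδ := c.δ_pos
  have hk := c.k_pos
  have ht' : (0 : ℝ) < t := by exact_mod_cast ht
  set α := 1 - β (t + 1) + γ (t + 1) * β (t + 1) - γ (t + 1 + 1) with hα
  have h1 := lintegral_mul_one_add_norm_sq_le h.sampling h.loss h.variance h.continuous_gradient
    (h.measurable_param t) (h.measurable_predictedError ht)
    (y := fun ω => Real.exp (c.ℓ * (q * sqrtGap D ℓ fstar X (t + 1) ω)))
    (Real.measurable_exp.comp (((h.measurable_sqrtGap t).const_mul q).const_mul c.ℓ))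
    (fun ω => (Real.exp_pos _).le) α (A := 1) (B := q ^ 2 / c.r) (C := 1 / (q ^ 2 * c.r))
    zero_le_one (by positivity) (by positivity)
  calc ∫⁻ ω, ENNReal.ofReal (lyapunov D ℓ fstar ξ γ X M c q (t + 1) ω) ∂P
      = _ := lintegral_congr fun ω => by
        rw [lyapunov, scaledError, h.shiftedError_succ ht ω, ← add_assoc]
        rfl
    _ ≤ _ := h1
    _ ≤ ∫⁻ ω, ENNReal.ofReal (Real.exp (-(c.ρ * (1 / q ^ 2))) *
          lyapunov D ℓ fstar ξ γ X M c q t ω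
        + Real.exp (c.ℓ * c.a₀) * (1 + c.k * c.a₀ ^ 2) * (1 / q ^ 2)) ∂P := by
      refine lintegral_mono_ae ?_
      filter_upwards [h.pl t ht] with ω hPL
      refine ENNReal.ofReal_le_ofReal (le_trans ?_ (h.lyapunov_drift hθ c ht hq hlow hup hPL))
      refine mul_le_mul_of_nonneg_left ?_ (Real.exp_pos _).le
      suffices hsuff : q ^ 2 / c.r * (‖predictedError D ℓ ξ β γ X M t ω‖ ^ 2 + α ^ 2 * σ ^ 2)
          + 1 / (q ^ 2 * c.r) * σ ^ 2
          ≤ (1 - 1 / q ^ 2 / 2) * scaledError D ℓ ξ γ X M q c.r t ω + c.ρ * (1 / q ^ 2) by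
        linarith
      have hU := h.norm_predictedError_sq_le ht ω
      have hαt : α ^ 2 ≤ 1 / t := by
        refine (h.schedule.noise_sq_le (t := t + 1) (by omega)).trans ?_
        push_cast
        gcongr
        linarith
      have hβ : β (t + 1) ≤ 1 - 1 / q ^ 2 / 2 := by
        refine (h.schedule.momentum_le (t + 1) (by omega)).trans ?_
        push_cast
        have h2 : √((t : ℝ) + 1 + 1) ≤ 2 * q ^ 2 := by
          rw [Real.sqrt_le_iff]
          refine ⟨by positivity, ?_⟩
          have : (1 : ℝ) ≤ q ^ 4 := one_le_pow₀ hq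
          nlinarith
        have h3 : (2 * q ^ 2)⁻¹ ≤ (√((t : ℝ) + 1 + 1))⁻¹ :=
          inv_anti₀ (Real.sqrt_pos.2 (by positivity)) h2
        have h4 : 1 / q ^ 2 / 2 = (2 * q ^ 2)⁻¹ := by field_simp
        rw [h4]
        linarith
      have h1t : 1 / (t : ℝ) ≤ 1 / (c.δ ^ 4 * q ^ 4) :=
        one_div_le_one_div_of_le (by positivity) hlow
      have hδ4 : c.δ ^ 4 ≤ 1 := pow_le_one₀ hδ.le (c.δ_le.trans (by norm_num))
      rw [scaledError]
      set s := ‖shiftedError D ℓ ξ γ X M t ω‖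
      set ν := ‖gradNoise D ℓ ξ X t ω‖
      have hν : 0 ≤ (1 - 1 / q ^ 2 / 2) * (1 / (q ^ 2 * c.r) * ν ^ 2) := by
        refine mul_nonneg ?_ (by positivity)
        linarith [h.schedule.momentum_nonneg (t + 1) (by omega)]
      have hU' : ‖predictedError D ℓ ξ β γ X M t ω‖ ^ 2 + α ^ 2 * σ ^ 2
          ≤ (1 - 1 / q ^ 2 / 2) * s ^ 2
            + (2 * (L * ((n : ℝ) + 1)) ^ 2 + σ ^ 2) * (1 / (c.δ ^ 4 * q ^ 4)) := by
        calc _ ≤ (β (t + 1) * s ^ 2 + 2 * (L * ((n : ℝ) + 1)) ^ 2 / t) + 1 / t * σ ^ 2 := by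
              gcongr
          _ = β (t + 1) * s ^ 2 + (2 * (L * ((n : ℝ) + 1)) ^ 2 + σ ^ 2) * (1 / t) := by ring
          _ ≤ _ := by gcongr
      have hσ : 1 / (q ^ 2 * c.r) * σ ^ 2 ≤ q ^ 2 / c.r * (σ ^ 2 * (1 / (c.δ ^ 4 * q ^ 4))) := by
        calc 1 / (q ^ 2 * c.r) * σ ^ 2 = q ^ 2 / c.r * (σ ^ 2 * (1 / (1 * q ^ 4))) := by
              field_simp
          _ ≤ _ := by gcongr
      have hfin : q ^ 2 / c.r * ((2 * (L * ((n : ℝ) + 1)) ^ 2 + 2 * σ ^ 2)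
          * (1 / (c.δ ^ 4 * q ^ 4))) ≤ c.ρ * (1 / q ^ 2) := by
        calc _ ≤ q ^ 2 / c.r * ((c.ρ * c.r * c.δ ^ 4) * (1 / (c.δ ^ 4 * q ^ 4))) := by
              gcongr; exact c.noise
          _ = c.ρ * (1 / q ^ 2) := by field_simp
      have hmul := mul_le_mul_of_nonneg_left hU' (show 0 ≤ q ^ 2 / c.r by positivity)
      linarith
    _ = _ := by
      simp only [ENNReal.ofReal_add (mul_nonneg (Real.exp_pos _).le
          (mul_nonneg (Real.exp_pos _).le (add_nonneg zero_le_one (scaledError_nonneg D ℓ ξ γ X M q hr t _))))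
          (show 0 ≤ Real.exp (c.ℓ * c.a₀) * (1 + c.k * c.a₀ ^ 2) * (1 / q ^ 2) by positivity),
        lyapunov, ENNReal.ofReal_mul (Real.exp_pos (-(c.ρ * (1 / q ^ 2)))).le]
      rw [lintegral_add_right _ measurable_const, lintegral_const_mul' _ _ ENNReal.ofReal_ne_top,
        lintegral_const, measure_univ, mul_one]

end IsMuonPLRun

/-! ### The start of the window -/

theorem eventually_exp_mul_le_one (a b : ℝ) {c : ℝ} (hc : 0 < c) (hb : 0 ≤ b) :
    ∀ᶠ q : ℝ in Filter.atTop, Real.exp (a * q - c * q ^ 2) * (1 + b * q ^ 6) ≤ 1 := by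
  have h1 : Filter.Tendsto (fun q : ℝ => q ^ 0 * Real.exp (-q) + b * (q ^ 6 * Real.exp (-q)))
      Filter.atTop (nhds (0 + b * 0)) :=
    (Real.tendsto_pow_mul_exp_neg_atTop_nhds_zero 0).add
      ((Real.tendsto_pow_mul_exp_neg_atTop_nhds_zero 6).const_mul b)
  rw [mul_zero, add_zero] at h1
  filter_upwards [h1.eventually_le_const zero_lt_one, Filter.eventually_ge_atTop 0,
    Filter.eventually_ge_atTop ((a + 1) / c)] with q hq hq0 hqa
  rw [div_le_iff₀ hc] at hqa
  calc Real.exp (a * q - c * q ^ 2) * (1 + b * q ^ 6) ≤ Real.exp (-q) * (1 + b * q ^ 6) := by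
        gcongr
        nlinarith
    _ = q ^ 0 * Real.exp (-q) + b * (q ^ 6 * Real.exp (-q)) := by ring
    _ ≤ 1 := hq

namespace IsMuonPLRun

variable {m n : ℕ} {Ξ Ω : Type*} [MeasurableSpace Ξ] {D : Measure Ξ}
  {ℓ : MatSpace m n → Ξ → ℝ} {fstar L σ μ : ℝ} [mΩ : MeasurableSpace Ω] {P : Measure Ω}
  {ℱ : Filtration ℕ mΩ} {ξ : ℕ → Ω → Ξ} {η β γ : ℕ → ℝ} {x₁ : MatSpace m n}
  {X M O : ℕ → Ω → MatSpace m n}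

theorem lintegral_gradNoise_sq_le [IsProbabilityMeasure P] [IsProbabilityMeasure D]
    (h : IsMuonPLRun D ℓ fstar L σ μ P ℱ ξ η β γ x₁ X M O) {t : ℕ} (ht : 1 ≤ t) :
    ∫⁻ ω, ENNReal.ofReal (‖gradNoise D ℓ ξ X t ω‖ ^ 2) ∂P ≤ ENNReal.ofReal (σ ^ 2) := by
  obtain ⟨t, rfl⟩ := Nat.exists_eq_add_of_le' ht
  have h1 := lintegral_mul_one_add_norm_sq_le h.sampling h.loss h.variance h.continuous_gradient
    (h.measurable_param t) (u := fun _ => 0) (y := fun _ => 1) measurable_const measurable_const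
    (fun _ => zero_le_one) 0 (A := 0) (B := 0) (C := 1) le_rfl le_rfl zero_le_one
  simpa [gradNoise] using h1

theorem lintegral_shiftedError_one_lt_top [IsProbabilityMeasure P] [IsProbabilityMeasure D]
    (h : IsMuonPLRun D ℓ fstar L σ μ P ℱ ξ η β γ x₁ X M O) :
    ∫⁻ ω, ENNReal.ofReal (‖shiftedError D ℓ ξ γ X M 1 ω‖ ^ 2) ∂P < ⊤ := by
  set b := 1 - β 1 + γ 1 * β 1 with hb
  have heq : ∀ ω, shiftedError D ℓ ξ γ X M 1 ω = (b - 1) • ∇ (objective D ℓ) x₁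
      + (b - γ 2) • (stochGrad ℓ (X 1 ω) (ξ 1 ω) - ∇ (objective D ℓ) (X 1 ω)) := by
    intro ω
    have hM := h.run.momentum 0 ω
    have hg0 : gradAt ℓ ξ X 0 ω = 0 := by simp [gradAt]
    have hg1 : gradAt ℓ ξ X (0 + 1) ω = stochGrad ℓ x₁ (ξ 1 ω) := by
      simp [gradAt, h.run.init_param]
    rw [h.run.init_momentum, hg0, hg1] at hM
    rw [zero_add] at hM
    rw [shiftedError, gradNoise, hM, h.run.init_param, hb]
    module
  have h1 := lintegral_mul_one_add_norm_sq_le h.sampling h.loss h.variance h.continuous_gradient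
    (h.measurable_param 0) (u := fun _ => (b - 1) • ∇ (objective D ℓ) x₁) (y := fun _ => 1)
    measurable_const measurable_const
    (fun _ => zero_le_one) (b - γ 2) (A := 0) (B := 1) (C := 0) le_rfl zero_le_one le_rfl
  simp only [zero_add, one_mul, zero_mul, add_zero, lintegral_const, measure_univ, mul_one] at h1
  simp only [heq]
  exact h1.trans_lt ENNReal.ofReal_lt_top

theorem lintegral_shiftedError_succ_le [IsProbabilityMeasure P] [IsProbabilityMeasure D]
    (h : IsMuonPLRun D ℓ fstar L σ μ P ℱ ξ η β γ x₁ X M O) {t : ℕ} (ht : 1 ≤ t) :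
    ∫⁻ ω, ENNReal.ofReal (‖shiftedError D ℓ ξ γ X M (t + 1) ω‖ ^ 2) ∂P
      ≤ ∫⁻ ω, ENNReal.ofReal (‖shiftedError D ℓ ξ γ X M t ω‖ ^ 2) ∂P
        + ENNReal.ofReal (2 * (L * ((n : ℝ) + 1)) ^ 2 + σ ^ 2) := by
  have ht' : (1 : ℝ) ≤ t := by exact_mod_cast ht
  set α := 1 - β (t + 1) + γ (t + 1) * β (t + 1) - γ (t + 1 + 1) with hα
  have hα1 : α ^ 2 ≤ 1 := by
    refine (h.schedule.noise_sq_le (t := t + 1) (by omega)).trans ?_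
    rw [div_le_one (by positivity)]
    push_cast; linarith
  have h1 := lintegral_mul_one_add_norm_sq_le h.sampling h.loss h.variance h.continuous_gradient
    (h.measurable_param t) (h.measurable_predictedError ht) (y := fun _ => 1) measurable_const
    (fun _ => zero_le_one) α (A := 0) (B := 1) (C := 0) le_rfl zero_le_one le_rfl
  simp only [zero_add, one_mul, zero_mul, add_zero] at h1
  calc _ = _ := lintegral_congr fun ω => by rw [h.shiftedError_succ ht ω]; rfl
    _ ≤ _ := h1
    _ ≤ ∫⁻ ω, (ENNReal.ofReal (‖shiftedError D ℓ ξ γ X M t ω‖ ^ 2)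
          + ENNReal.ofReal (2 * (L * ((n : ℝ) + 1)) ^ 2 + σ ^ 2)) ∂P := by
      refine lintegral_mono fun ω => ?_
      rw [← ENNReal.ofReal_add (by positivity) (by positivity)]
      refine ENNReal.ofReal_le_ofReal ?_
      have hU := h.norm_predictedError_sq_le ht ω
      have hβ : β (t + 1) * ‖shiftedError D ℓ ξ γ X M t ω‖ ^ 2
          ≤ 1 * ‖shiftedError D ℓ ξ γ X M t ω‖ ^ 2 := by
        gcongr
        exact h.schedule.momentum_le_one (by omega)
      have h2 : 2 * (L * ((n : ℝ) + 1)) ^ 2 / t ≤ 2 * (L * ((n : ℝ) + 1)) ^ 2 :=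
        div_le_self (by positivity) ht'
      have h3 : α ^ 2 * σ ^ 2 ≤ 1 * σ ^ 2 := by gcongr
      linarith
    _ = _ := by
      rw [lintegral_add_right _ measurable_const, lintegral_const, measure_univ, mul_one]

/-- A crude bound on the second moments of the errors. -/
theorem exists_lintegral_error_le [IsProbabilityMeasure P] [IsProbabilityMeasure D]
    (h : IsMuonPLRun D ℓ fstar L σ μ P ℱ ξ η β γ x₁ X M O) :
    ∃ J : ℝ, 0 ≤ J ∧ ∀ t : ℕ, 1 ≤ t →
      ∫⁻ ω, ENNReal.ofReal (‖shiftedError D ℓ ξ γ X M t ω‖ ^ 2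
        + ‖gradNoise D ℓ ξ X t ω‖ ^ 2) ∂P ≤ ENNReal.ofReal (J * t) := by
  set J₁ := (∫⁻ ω, ENNReal.ofReal (‖shiftedError D ℓ ξ γ X M 1 ω‖ ^ 2) ∂P).toReal with hJ₁
  set K := 2 * (L * ((n : ℝ) + 1)) ^ 2 + σ ^ 2 with hK
  have hK0 : 0 ≤ K := by positivity
  have hJ0 : 0 ≤ J₁ := ENNReal.toReal_nonneg
  have hS : ∀ t : ℕ, 1 ≤ t → ∫⁻ ω, ENNReal.ofReal (‖shiftedError D ℓ ξ γ X M t ω‖ ^ 2) ∂P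
      ≤ ENNReal.ofReal (J₁ + K * t) := by
    intro t ht
    induction t, ht using Nat.le_induction with
    | base =>
      rw [← ENNReal.ofReal_toReal h.lintegral_shiftedError_one_lt_top.ne]
      refine ENNReal.ofReal_le_ofReal ?_
      rw [← hJ₁, Nat.cast_one, mul_one]
      exact le_add_of_nonneg_right hK0
    | succ t ht ih =>
      refine (h.lintegral_shiftedError_succ_le ht).trans ((add_le_add_left ih _).trans ?_)
      rw [← ENNReal.ofReal_add (by positivity) hK0]
      refine ENNReal.ofReal_le_ofReal (le_of_eq ?_)
      push_cast; ring
  refine ⟨J₁ + K + σ ^ 2, by positivity, fun t ht => ?_⟩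
  have ht' : (1 : ℝ) ≤ t := by exact_mod_cast ht
  calc _ = ∫⁻ ω, (ENNReal.ofReal (‖shiftedError D ℓ ξ γ X M t ω‖ ^ 2)
        + ENNReal.ofReal (‖gradNoise D ℓ ξ X t ω‖ ^ 2)) ∂P :=
        lintegral_congr fun ω => ENNReal.ofReal_add (by positivity) (by positivity)
    _ = ∫⁻ ω, ENNReal.ofReal (‖shiftedError D ℓ ξ γ X M t ω‖ ^ 2) ∂P
        + ∫⁻ ω, ENNReal.ofReal (‖gradNoise D ℓ ξ X t ω‖ ^ 2) ∂P :=
        lintegral_add_left (((h.measurable_shiftedError ht).mono (ℱ.le t) le_rfl).norm.pow_const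
          2).ennreal_ofReal _
    _ ≤ ENNReal.ofReal (J₁ + K * t) + ENNReal.ofReal (σ ^ 2) :=
        add_le_add (hS t ht) (h.lintegral_gradNoise_sq_le ht)
    _ = ENNReal.ofReal (J₁ + K * t + σ ^ 2) :=
        (ENNReal.ofReal_add (by positivity) (by positivity)).symm
    _ ≤ _ := by
        refine ENNReal.ofReal_le_ofReal ?_
        nlinarith [mul_le_mul_of_nonneg_left ht' hJ0, mul_le_mul_of_nonneg_left ht' (sq_nonneg σ)]

/-- A bound for the Lyapunov function at a given time from the deterministic bound for the gap and
the crude moment bound. -/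
theorem lintegral_lyapunov_le [IsProbabilityMeasure P]
    (h : IsMuonPLRun D ℓ fstar L σ μ P ℱ ξ η β γ x₁ X M O) {θ : ℝ}
    (c : DriftConstants L σ ((n : ℝ) + 1) θ) {J q : ℝ} {t : ℕ} (ht : 1 ≤ t) (hq : 1 ≤ q)
    (hJ0 : 0 ≤ J)
    (hJ : ∫⁻ ω, ENNReal.ofReal (‖shiftedError D ℓ ξ γ X M t ω‖ ^ 2
        + ‖gradNoise D ℓ ξ X t ω‖ ^ 2) ∂P ≤ ENNReal.ofReal (J * t)) :
    ∫⁻ ω, ENNReal.ofReal (lyapunov D ℓ fstar ξ γ X M c q t ω) ∂P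
      ≤ ENNReal.ofReal (Real.exp (c.ℓ * (q * (√(objective D ℓ x₁ - fstar)
          + 8 * (((n : ℝ) + 1) * √(L / 2)) * (t : ℝ) ^ (1 / 4 : ℝ))))
          * (1 + q ^ 2 / c.r * (J * t))) := by
  have hq0 : 0 < q := by linarith
  have hr := c.r_pos
  have hℓ := c.ℓ_pos
  set E := Real.exp (c.ℓ * (q * (√(objective D ℓ x₁ - fstar)
          + 8 * (((n : ℝ) + 1) * √(L / 2)) * (t : ℝ) ^ (1 / 4 : ℝ))))
  have hE : 0 ≤ E := (Real.exp_pos _).le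
  calc ∫⁻ ω, ENNReal.ofReal (lyapunov D ℓ fstar ξ γ X M c q t ω) ∂P
      ≤ ∫⁻ ω, ENNReal.ofReal E * (1 + ENNReal.ofReal (q ^ 2 / c.r) * ENNReal.ofReal
          (‖shiftedError D ℓ ξ γ X M t ω‖ ^ 2 + ‖gradNoise D ℓ ξ X t ω‖ ^ 2)) ∂P := by
        refine lintegral_mono fun ω => ?_
        rw [← ENNReal.ofReal_mul (by positivity), ← ENNReal.ofReal_one,
          ← ENNReal.ofReal_add zero_le_one (by positivity), ← ENNReal.ofReal_mul hE]
        refine ENNReal.ofReal_le_ofReal ?_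
        have hgap := h.sqrtGap_le ht ω
        rw [lyapunov, scaledError, mul_add (q ^ 2 / c.r)]
        have hexp : Real.exp (c.ℓ * (q * sqrtGap D ℓ fstar X t ω)) ≤ E :=
          Real.exp_le_exp.2 (by gcongr)
        have hcoef : 1 / (q ^ 2 * c.r) ≤ q ^ 2 / c.r := by
          rw [div_le_div_iff₀ (by positivity) hr]
          have h1 : 1 ≤ q ^ 2 := one_le_pow₀ hq
          have h2 : 1 * c.r ≤ q ^ 2 * q ^ 2 * c.r := by
            gcongr
            nlinarith
          linarith
        gcongr
    _ = ENNReal.ofReal E * (1 + ENNReal.ofReal (q ^ 2 / c.r) * ∫⁻ ω, ENNReal.ofReal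
          (‖shiftedError D ℓ ξ γ X M t ω‖ ^ 2 + ‖gradNoise D ℓ ξ X t ω‖ ^ 2) ∂P) := by
        rw [lintegral_const_mul' _ _ ENNReal.ofReal_ne_top, lintegral_add_left measurable_const,
          lintegral_const_mul' _ _ ENNReal.ofReal_ne_top, lintegral_const, measure_univ, mul_one]
    _ ≤ ENNReal.ofReal E * (1 + ENNReal.ofReal (q ^ 2 / c.r) * ENNReal.ofReal (J * t)) := by
        gcongr
    _ = _ := by
        rw [← ENNReal.ofReal_mul (by positivity), ← ENNReal.ofReal_one,
          ← ENNReal.ofReal_add zero_le_one (by positivity), ← ENNReal.ofReal_mul hE]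

/-! ### The rate -/

/-- After a threshold that depends on the run, the expected Lyapunov function is bounded by a
constant that does not. -/
theorem exists_lintegral_lyapunov_le [IsProbabilityMeasure P] [IsProbabilityMeasure D]
    (h : IsMuonPLRun D ℓ fstar L σ μ P ℱ ξ η β γ x₁ X M O) {θ : ℝ}
    (hθ : θ = √(2 * μ) / (2 * ((n : ℝ) + 1))) (c : DriftConstants L σ ((n : ℝ) + 1) θ) :
    ∃ T₀ : ℕ, 1 ≤ T₀ ∧ ∀ T : ℕ, T₀ ≤ T →
      ∫⁻ ω, ENNReal.ofReal (lyapunov D ℓ fstar ξ γ X M c ((T : ℝ) ^ (1 / 4 : ℝ)) T ω) ∂P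
        ≤ ENNReal.ofReal (1 + 2 * (Real.exp (c.ℓ * c.a₀) * (1 + c.k * c.a₀ ^ 2)) / c.ρ) := by
  obtain ⟨J, hJ0, hJ⟩ := h.exists_lintegral_error_le
  have hδ := c.δ_pos
  have hδ1 := c.δ_le
  have hr := c.r_pos
  have hρ := c.ρ_pos
  have hℓ := c.ℓ_pos
  have hk := c.k_pos
  set A₁ := √(objective D ℓ x₁ - fstar) with hA₁
  set C₀ := ((n : ℝ) + 1) * √(L / 2) with hC₀
  have hC₀0 : 0 ≤ C₀ := by positivity
  have hq : Filter.Tendsto (fun T : ℕ => (T : ℝ) ^ (1 / 4 : ℝ)) Filter.atTop Filter.atTop :=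
    (tendsto_rpow_atTop (by norm_num)).comp tendsto_natCast_atTop_atTop
  have hev := (hq.eventually (eventually_exp_mul_le_one (c.ℓ * A₁) (J / c.r)
    (show 0 < c.ρ / 4 by positivity) (by positivity))).and
      (tendsto_natCast_atTop_atTop.eventually (Filter.eventually_ge_atTop (1 / c.δ ^ 4)))
  obtain ⟨T₀, hT₀⟩ := Filter.eventually_atTop.1 hev
  refine ⟨max 1 T₀, le_max_left _ _, fun T hT => ?_⟩
  obtain ⟨hexp, hTδ⟩ := hT₀ T ((le_max_right _ _).trans hT)
  have hT1 : 1 ≤ T := (le_max_left _ _).trans hT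
  have hT1' : (1 : ℝ) ≤ T := by exact_mod_cast hT1
  have hq4 := rpow_quarter_pow T
  have hq1 : 1 ≤ (T : ℝ) ^ (1 / 4 : ℝ) := Real.one_le_rpow hT1' (by norm_num)
  set q := (T : ℝ) ^ (1 / 4 : ℝ)
  have hq0 : 0 < q := by linarith
  rw [div_le_iff₀ (by positivity)] at hTδ
  -- The window starts at `t₀`, which lies between `δ ^ 4 * T` and twice that number.
  set t₀ := ⌈c.δ ^ 4 * (T : ℝ)⌉₊ with ht₀
  have hδT : 1 ≤ c.δ ^ 4 * (T : ℝ) := by linarith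
  have ht₀low : c.δ ^ 4 * (T : ℝ) ≤ t₀ := Nat.le_ceil _
  have ht₀up : (t₀ : ℝ) ≤ 2 * (c.δ ^ 4 * (T : ℝ)) := by
    have := Nat.ceil_lt_add_one (show 0 ≤ c.δ ^ 4 * (T : ℝ) by positivity)
    linarith
  have hδ4 : c.δ ^ 4 ≤ 1 / 16 := by
    calc c.δ ^ 4 ≤ (1 / 2) ^ 4 := by gcongr
      _ = 1 / 16 := by norm_num
  have ht₀half : (t₀ : ℝ) ≤ T / 2 := by nlinarith
  have ht₀1 : 1 ≤ t₀ := by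
    have : (1 : ℝ) ≤ t₀ := by linarith
    exact_mod_cast this
  have ht₀T : t₀ ≤ T := by
    have : (t₀ : ℝ) ≤ T := by linarith
    exact_mod_cast this
  -- The deterministic bound for the square root of the gap at `t₀` is thus of order `δ * q`.
  have hquart : (t₀ : ℝ) ^ (1 / 4 : ℝ) ≤ 2 * c.δ * q := by
    refine le_of_pow_le_pow_left₀ (n := 4) (by norm_num) (by positivity) ?_
    rw [rpow_quarter_pow, mul_pow, mul_pow, hq4]
    nlinarith
  set B := Real.exp (c.ℓ * c.a₀) * (1 + c.k * c.a₀ ^ 2) with hB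
  have hB0 : 0 ≤ B := by positivity
  have hrec := le_exp_mul_add_of_recursion
    (u := fun t => ∫⁻ ω, ENNReal.ofReal (lyapunov D ℓ fstar ξ γ X M c q t ω) ∂P) (ρ := c.ρ)
    (h := 1 / q ^ 2) (B := B) (t₀ := t₀) (T := T) (by positivity) hρ
    (by
      have h1 : 1 / q ^ 2 ≤ 1 := by
        rw [div_le_one (by positivity)]; exact one_le_pow₀ hq1
      have := c.ρ_le
      nlinarith) hB0 ht₀T
    (fun t ht1 ht2 => h.lintegral_lyapunov_succ_le hθ c (ht₀1.trans ht1) hq1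
      (by
        rw [hq4]
        exact ht₀low.trans (by exact_mod_cast ht1))
      (by rw [hq4]; exact_mod_cast ht2.le))
  refine hrec.trans ?_
  have hinit := h.lintegral_lyapunov_le c ht₀1 hq1 hJ0 (hJ t₀ ht₀1)
  refine (add_le_add_left (mul_le_mul_right hinit _) _).trans ?_
  rw [← ENNReal.ofReal_mul (Real.exp_pos _).le, ← ENNReal.ofReal_add (by positivity)
    (by positivity)]
  refine ENNReal.ofReal_le_ofReal (add_le_add_left ?_ _)
  rw [← mul_assoc, ← Real.exp_add]
  refine le_trans ?_ hexp
  gcongr ?_ * (1 + ?_)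
  · apply Real.exp_le_exp.2
    have h1 : c.ρ * (1 / q ^ 2) * (q ^ 4 / 2) ≤ c.ρ * (1 / q ^ 2) * ((T : ℝ) - t₀) := by
      gcongr
      rw [hq4]; linarith
    have h2 : c.ρ * (1 / q ^ 2) * (q ^ 4 / 2) = c.ρ / 2 * q ^ 2 := by field_simp
    have h3 : c.ℓ * (q * (A₁ + 8 * C₀ * (t₀ : ℝ) ^ (1 / 4 : ℝ)))
        ≤ c.ℓ * (q * (A₁ + 8 * C₀ * (2 * c.δ * q))) := by gcongr
    have h4 : 16 * C₀ * c.δ * c.ℓ * q ^ 2 ≤ c.ρ / 4 * q ^ 2 := by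
      have := c.start
      gcongr
    linarith
  · calc q ^ 2 / c.r * (J * t₀) ≤ q ^ 2 / c.r * (J * q ^ 4) := by
          gcongr
          rw [hq4]; linarith
      _ = J / c.r * q ^ 6 := by ring

theorem integrable_sqrtGap_sq [IsProbabilityMeasure P]
    (h : IsMuonPLRun D ℓ fstar L σ μ P ℱ ξ η β γ x₁ X M O) (t : ℕ) :
    Integrable (fun ω => sqrtGap D ℓ fstar X (t + 1) ω ^ 2) P := by
  refine Integrable.of_bound (C := (√(objective D ℓ x₁ - fstar)
        + 8 * (((n : ℝ) + 1) * √(L / 2)) * ((t + 1 : ℕ) : ℝ) ^ (1 / 4 : ℝ)) ^ 2)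
    ((((h.measurable_sqrtGap t).mono (ℱ.le t) le_rfl).pow_const 2).aestronglyMeasurable)
    (Filter.Eventually.of_forall fun ω => ?_)
  rw [Real.norm_of_nonneg (sq_nonneg _)]
  exact pow_le_pow_left₀ (Real.sqrt_nonneg _) (h.sqrtGap_le (by omega) ω) 2

/-- The exponential in the Lyapunov function dominates the square of its argument. -/
theorem integral_sqrtGap_sq_le [IsProbabilityMeasure P]
    (h : IsMuonPLRun D ℓ fstar L σ μ P ℱ ξ η β γ x₁ X M O) {θ : ℝ}
    (c : DriftConstants L σ ((n : ℝ) + 1) θ) {t : ℕ} {q K : ℝ} (hq : 0 < q) (hK : 0 ≤ K)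
    (hle : ∫⁻ ω, ENNReal.ofReal (lyapunov D ℓ fstar ξ γ X M c q (t + 1) ω) ∂P
      ≤ ENNReal.ofReal K) :
    ∫ ω, sqrtGap D ℓ fstar X (t + 1) ω ^ 2 ∂P ≤ 2 / c.ℓ ^ 2 * K * (1 / q ^ 2) := by
  have hℓ := c.ℓ_pos
  rw [← ENNReal.ofReal_le_ofReal_iff (by positivity), ofReal_integral_eq_lintegral_ofReal
    (h.integrable_sqrtGap_sq t) (Filter.Eventually.of_forall fun ω => sq_nonneg _)]
  calc ∫⁻ ω, ENNReal.ofReal (sqrtGap D ℓ fstar X (t + 1) ω ^ 2) ∂P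
      ≤ ∫⁻ ω, ENNReal.ofReal (2 / c.ℓ ^ 2 * (1 / q ^ 2)) *
          ENNReal.ofReal (lyapunov D ℓ fstar ξ γ X M c q (t + 1) ω) ∂P := by
        refine lintegral_mono fun ω => ?_
        rw [← ENNReal.ofReal_mul (by positivity)]
        refine ENNReal.ofReal_le_ofReal ?_
        have hs0 : 0 ≤ sqrtGap D ℓ fstar X (t + 1) ω := Real.sqrt_nonneg _
        have hw := scaledError_nonneg D ℓ ξ γ X M q c.r_pos (t + 1) ω
        rw [lyapunov]
        set s := sqrtGap D ℓ fstar X (t + 1) ω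
        have h1 := Real.quadratic_le_exp_of_nonneg (show 0 ≤ c.ℓ * (q * s) by positivity)
        have h2 : (c.ℓ * (q * s)) ^ 2 / 2 ≤ Real.exp (c.ℓ * (q * s)) *
            (1 + scaledError D ℓ ξ γ X M q c.r (t + 1) ω) := by
          have h3 : 0 ≤ c.ℓ * (q * s) := by positivity
          have h4 : Real.exp (c.ℓ * (q * s)) * 1 ≤ Real.exp (c.ℓ * (q * s)) *
            (1 + scaledError D ℓ ξ γ X M q c.r (t + 1) ω) := by
            gcongr
            linarith
          linarith
        calc s ^ 2 = 2 / c.ℓ ^ 2 * (1 / q ^ 2) * ((c.ℓ * (q * s)) ^ 2 / 2) := by field_simp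
          _ ≤ _ := by gcongr
    _ = ENNReal.ofReal (2 / c.ℓ ^ 2 * (1 / q ^ 2)) *
          ∫⁻ ω, ENNReal.ofReal (lyapunov D ℓ fstar ξ γ X M c q (t + 1) ω) ∂P :=
        lintegral_const_mul' _ _ ENNReal.ofReal_ne_top
    _ ≤ ENNReal.ofReal (2 / c.ℓ ^ 2 * (1 / q ^ 2)) * ENNReal.ofReal K := by gcongr
    _ = _ := by
        rw [← ENNReal.ofReal_mul (by positivity)]
        congr 1; ring

end IsMuonPLRun

theorem mainTheorem3 (n : ℕ) (L σ μ : ℝ) (hL : 0 < L) (hσ : 0 < σ) (hμ : 0 < μ) :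
    ∃ C : ℝ, 0 < C ∧
      ∀ (m : ℕ), n ≤ m →
      ∀ (Ξ : Type*) [MeasurableSpace Ξ] (D : Measure Ξ) [IsProbabilityMeasure D]
        (ℓ : MatSpace m n → Ξ → ℝ) (fstar : ℝ),
        IsSampleLoss D ℓ →
        (∀ X, fstar ≤ objective D ℓ X) →
        IsLSmooth (objective D ℓ) L →
        HasBoundedVariance D ℓ σ →
      ∀ (Ω : Type*) [MeasurableSpace Ω] (P : Measure Ω) [IsProbabilityMeasure P]
        (ℱ : Filtration ℕ ‹MeasurableSpace Ω›) (ξ : ℕ → Ω → Ξ),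
        IsSampling P D ℱ ξ →
      ∀ (η β γ : ℕ → ℝ) (x₁ : MatSpace m n) (X M O : ℕ → Ω → MatSpace m n),
        (∀ t : ℕ, 1 ≤ t → η t = (t : ℝ) ^ (-(3 / 4) : ℝ)) →
        ((∀ t : ℕ, 1 ≤ t → γ t = 0 ∧ β t = 1 - (t : ℝ) ^ (-(1 / 2) : ℝ)) ∨
          (∀ t : ℕ, 1 ≤ t → γ t = (t : ℝ) ^ (-(1 / 2) : ℝ) ∧
            β t = 1 - ((t : ℝ) + 1) ^ (-(1 / 2) : ℝ))) →
        IsMuonMVR1Run ℓ ℱ ξ η β γ x₁ X M O →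
        (∀ t, 1 ≤ t → ∀ᵐ ω ∂P, PLAt (objective D ℓ) fstar μ (X t ω)) →
        ∃ T₀ : ℕ, ∀ T : ℕ, T₀ ≤ T →
          Integrable (fun ω => objective D ℓ (X (T + 1) ω)) P ∧
          ∫ ω, objective D ℓ (X (T + 1) ω) ∂P - fstar
            ≤ C * ((Real.log T) ^ 2 / (T : ℝ) ^ (1 / 2 : ℝ)) := by
  have hθ : 0 < √(2 * μ) / (2 * ((n : ℝ) + 1)) := by
    have := Real.sqrt_pos.2 (mul_pos two_pos hμ)
    positivity
  obtain ⟨c⟩ := nonempty_driftConstants σ hL (show (0 : ℝ) < (n : ℝ) + 1 by positivity) hθ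
  have hℓ := c.ℓ_pos
  have hρ := c.ρ_pos
  have hk := c.k_pos
  set K := 1 + 2 * (Real.exp (c.ℓ * c.a₀) * (1 + c.k * c.a₀ ^ 2)) / c.ρ with hK
  have hK0 : 0 < K := by positivity
  refine ⟨2 / c.ℓ ^ 2 * K, by positivity, ?_⟩
  intro m hmn Ξ _ D _ ℓ fstar hloss hlow hsmooth hvar Ω _ P _ ℱ ξ hsamp η β γ x₁ X M O hη hopt hrun
    hPL
  have h : IsMuonPLRun D ℓ fstar L σ μ P ℱ ξ η β γ x₁ X M O :=
    ⟨hmn, hL, hμ, hloss, hlow, hsmooth, hvar, hsamp, isMuonSchedule_of_options hη hopt, hrun, hPL⟩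
  obtain ⟨T₀, hT₀, hbound⟩ := h.exists_lintegral_lyapunov_le rfl c
  refine ⟨max 3 T₀, fun T hT => ?_⟩
  have hT3 : (3 : ℝ) ≤ T := by exact_mod_cast (le_max_left 3 T₀).trans hT
  have hTT : T₀ ≤ T + 1 := ((le_max_right 3 T₀).trans hT).trans (Nat.le_succ T)
  have hsq : ∀ ω, objective D ℓ (X (T + 1) ω) = sqrtGap D ℓ fstar X (T + 1) ω ^ 2 + fstar := by
    intro ω
    rw [sqrtGap, Real.sq_sqrt (sub_nonneg.2 (hlow _))]
    ring
  have hint := h.integrable_sqrtGap_sq T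
  have hq4 := rpow_quarter_pow (T + 1)
  have hq0 : 0 < ((T + 1 : ℕ) : ℝ) ^ (1 / 4 : ℝ) := Real.rpow_pos_of_pos (by positivity) _
  have hmain := h.integral_sqrtGap_sq_le c hq0 hK0.le (hbound (T + 1) hTT)
  simp only [hsq]
  refine ⟨hint.add (integrable_const _), ?_⟩
  rw [integral_add hint (integrable_const _), integral_const, probReal_univ, one_smul,
    add_sub_cancel_right]
  refine hmain.trans (mul_le_mul_of_nonneg_left ?_ (by positivity))
  set q := ((T + 1 : ℕ) : ℝ) ^ (1 / 4 : ℝ)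
  have hroot : (T : ℝ) ^ (1 / 2 : ℝ) ≤ q ^ 2 := by
    rw [← Real.sqrt_eq_rpow, Real.sqrt_le_iff]
    refine ⟨by positivity, ?_⟩
    rw [← pow_mul, hq4]
    push_cast; linarith
  -- The bound without logarithms implies the claim since `log T ≥ 1` for `T ≥ 3`.
  have hlog : 1 ≤ Real.log T := by
    rw [Real.le_log_iff_exp_le (by linarith)]
    exact Real.exp_one_lt_three.le.trans hT3
  gcongr
  exact one_le_pow₀ hlog
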